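/- For $N\ge 1$ qubits with Pauli matrices $\sigma^x_l,\sigma^z_l$ ($1\le l\le N$) and parameters $(\mathbf h,\mathbf J)=\big((h_l^x,h_l^z)_{1\le l\le N},(J_l)_{1\le l\le N-1}\big)\in\mathbb R^{3N-1}$, consider the Hamiltonian $H(t)=H(t+1)$ given by $$H(t)=\begin{cases}H_1':=\sum_{l=1}^N h_l^z\sigma_l^z+\sum_{l=1}^{N-1}J_l\sigma_l^z\sigma_{l+1}^z,&0\le t<1/2,\\ H_2':=\sum_{l=1}^N h_l^x\sigma_l^x,&1/2\le t<1,\end{cases}$$ let $U(0,t)=\mathcal Te^{-i\int_0^tH(s)\,\mathrm ds}$ be its time-evolution operator, and let $|\psi(t)\rangle=U(0,t)|\psi(0)\rangle$ for $t\ge0$. The initial state $|\psi(0)\rangle=\bigotimes_{l=1}^N|\phi_l\rangle$ is a Haar-random product state: the $|\phi_l\rangle$ are independent and uniformly distributed on the unit sphere of $\mathbb C^2$. A function $f$ of time is called $\epsilon$-periodic (with period $1$) if there is a measurable function $\bar f:[0,1)\to\mathbb R$ such that $$\liminf_{M\to\infty}\frac1M\left|\left\{m\in\{0,1,\ldots,M-1\}:\int_0^1|f(m+x)-\bar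 f(x)|^2\,\mathrm dx\le\epsilon\right\}\right|\ge1-\epsilon .$$ There exist absolute constants $c>0$ and $N_0$ such that for every $N\ge N_0$ there is a set of Lebesgue measure zero in $\mathbb R^{3N-1}$ with the following property: for every $(\mathbf h,\mathbf J)\in\mathbb R^{3N-1}$ outside this set and every Hermitian operator $A$ on $(\mathbb C^2)^{\otimes N}$ with operator norm $\|A\|=1$, with probability at least $1-e^{-cN}$ over $|\psi(0)\rangle$ the function $t\mapsto\langle\psi(t)|A|\psi(t)\rangle$ is $e^{-cN}$-periodic. -/

import Mathlib

open MeasureTheory Filter Topology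
open scoped Matrix Matrix.Norms.L2Operator

noncomputable section

namespace KickedIsing

/-! ### Qubits and operators -/

/-- Computational basis of `N` qubits: bit strings of length `N`. The value `0` is the spin-up
state (`σᶻ = 1`) and the value `1` is the spin-down state (`σᶻ = -1`). -/
abbrev Basis (N : ℕ) : Type := Fin N → Fin 2

/-- Linear operators on the Hilbert space `(ℂ²)^{⊗N}`, as matrices in the computational basis.
The norm in force on them is the operator norm induced by the Hilbert space norm. -/
abbrev Op (N : ℕ) : Type := Matrix (Basis N) (Basis N) ℂ

/-- The Pauli matrix `σˣ`. -/
def pauliX : Matrix (Fin 2) (Fin 2) ℂ := !![0, 1; 1, 0]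

/-- The Pauli matrix `σᶻ`. -/
def pauliZ : Matrix (Fin 2) (Fin 2) ℂ := !![1, 0; 0, -1]

/-- The one-qubit operator `M` acting on qubit `l`, i.e. `1 ⊗ ⋯ ⊗ M ⊗ ⋯ ⊗ 1`. -/
def onSite {N : ℕ} (l : Fin N) (M : Matrix (Fin 2) (Fin 2) ℂ) : Op N :=
  Matrix.of fun s s' => if ∀ k, k ≠ l → s k = s' k then M (s l) (s' l) else 0

/-! ### The model -/

/-- The parameters `(𝐡, 𝐉) ∈ ℝ^{3N-1}`: the fields `(hˣ_l)_{1 ≤ l ≤ N}`, the fields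
`(hᶻ_l)_{1 ≤ l ≤ N}` and the couplings `(J_l)_{1 ≤ l ≤ N-1}`. -/
abbrev Params (N : ℕ) : Type := (Fin N → ℝ) × (Fin N → ℝ) × (Fin (N - 1) → ℝ)

/-- Left end `l` of the bond `(l, l+1)`. -/
def bondLeft {N : ℕ} (l : Fin (N - 1)) : Fin N := ⟨l, by omega⟩

/-- Right end `l+1` of the bond `(l, l+1)`. -/
def bondRight {N : ℕ} (l : Fin (N - 1)) : Fin N := ⟨l + 1, by omega⟩

/-- `H'₁ = ∑ hᶻ_l σᶻ_l + ∑ J_l σᶻ_l σᶻ_{l+1}`. -/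
def H₁ {N : ℕ} (p : Params N) : Op N :=
  ∑ l : Fin N, (p.2.1 l : ℂ) • onSite l pauliZ +
    ∑ l : Fin (N - 1), (p.2.2 l : ℂ) • (onSite (bondLeft l) pauliZ * onSite (bondRight l) pauliZ)

/-- `H'₂ = ∑ hˣ_l σˣ_l`. -/
def H₂ {N : ℕ} (p : Params N) : Op N :=
  ∑ l : Fin N, (p.1 l : ℂ) • onSite l pauliX

/-- The time-dependent Hamiltonian, of period `1`: `H'₁` on `[0, 1/2)` and `H'₂` on `[1/2, 1)`. -/
def hamiltonian {N : ℕ} (p : Params N) (t : ℝ) : Op N :=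
  if Int.fract t < 1 / 2 then H₁ p else H₂ p

/-- The time-evolution operator `U(0, x)` for `0 ≤ x ≤ 1`: evolution with `H'₁` for the time
`min x (1/2)`, then with `H'₂` for the remaining time. -/
def partialPeriod {N : ℕ} (p : Params N) (x : ℝ) : Op N :=
  NormedSpace.exp ((max (x - 1 / 2) 0 : ℝ) • (-Complex.I • H₂ p)) *
    NormedSpace.exp ((min x (1 / 2) : ℝ) • (-Complex.I • H₁ p))

/-- The Floquet operator `U_F = U(0, 1)`. -/
def floquetOp {N : ℕ} (p : Params N) : Op N := partialPeriod p 1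

/-- The time-evolution operator `U(0, t)`, `t ≥ 0`: the time-ordered exponential of the
piecewise constant Hamiltonian (see `propagator_zero`, `continuousOn_propagator` and
`hasDerivWithinAt_propagator`). -/
def propagator {N : ℕ} (p : Params N) (t : ℝ) : Op N :=
  partialPeriod p (Int.fract t) * floquetOp p ^ ⌊t⌋₊

/-- The expectation value `⟨ψ(t)|A|ψ(t)⟩` with `|ψ(t)⟩ = U(0, t)|ψ(0)⟩`. For Hermitian `A` this
complex number is real. -/
def expectation {N : ℕ} (p : Params N) (A : Op N) (ψ₀ : Basis N → ℂ) (t : ℝ) : ℝ :=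
  (star (propagator p t *ᵥ ψ₀) ⬝ᵥ (A *ᵥ (propagator p t *ᵥ ψ₀))).re

/-! ### Haar-random product states -/

/-- Pure states of one qubit: unit vectors of `ℂ²`. -/
abbrev QubitState : Type := Metric.sphere (0 : EuclideanSpace ℂ (Fin 2)) 1

/-- The Haar measure on states of one qubit: the uniform probability measure on the unit sphere
of `ℂ²`, i.e. the normalized surface measure. -/
def haarQubit : Measure QubitState :=
  ((volume : Measure (EuclideanSpace ℂ (Fin 2))).toSphere Set.univ)⁻¹ •
    (volume : Measure (EuclideanSpace ℂ (Fin 2))).toSphere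

/-- The law of the `N` independent Haar-random one-qubit states `|φ₁⟩, …, |φ_N⟩`. -/
def haarProduct (N : ℕ) : Measure (Fin N → QubitState) :=
  Measure.pi fun _ => haarQubit

/-- The product state `|φ₁⟩ ⊗ ⋯ ⊗ |φ_N⟩`. -/
def productState {N : ℕ} (φ : Fin N → QubitState) : Basis N → ℂ :=
  fun s => ∏ l, (φ l : EuclideanSpace ℂ (Fin 2)) (s l)

/-! ### Approximately periodic functions -/

/-- `[m, m+1)` is a good period: the squared `L²` distance on it between `f` and the translate of
`g` (of which only the restriction to `[0, 1)` matters) is at most `ε`. -/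
def IsGoodPeriod (ε : ℝ) (f g : ℝ → ℝ) (m : ℕ) : Prop :=
  IntegrableOn (fun x : ℝ => |f (m + x) - g x| ^ 2) (Set.Ico 0 1) ∧
    ∫ x in Set.Ico (0 : ℝ) 1, |f (m + x) - g x| ^ 2 ≤ ε

open Classical in
/-- `f` is `ε`-periodic with period `1`: for some measurable `g` on `[0, 1)`, the lower asymptotic
density of the good periods is at least `1 - ε`. -/
def IsApproxPeriodic (ε : ℝ) (f : ℝ → ℝ) : Prop :=
  ∃ g : ℝ → ℝ, Measurable g ∧
    1 - ε ≤ liminf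
      (fun M : ℕ => (((Finset.range M).filter (IsGoodPeriod ε f g)).card : ℝ) / (M : ℝ)) atTop

/-! ### Sanity checks on the definitions -/

instance : IsProbabilityMeasure haarQubit := by
  constructor
  have h0 : (volume : Measure (EuclideanSpace ℂ (Fin 2))).toSphere Set.univ ≠ 0 := by
    rw [Ne, Measure.measure_univ_eq_zero]
    exact Measure.toSphere_ne_zero _
  rw [haarQubit, Measure.smul_apply, smul_eq_mul]
  exact ENNReal.inv_mul_cancel h0 (measure_ne_top _ _)

instance (N : ℕ) : IsProbabilityMeasure (haarProduct N) := by
  unfold haarProduct; infer_instance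

theorem continuous_partialPeriod {N : ℕ} (p : Params N) : Continuous (partialPeriod p) := by
  unfold partialPeriod
  let _ : NormedAlgebra ℚ (Op N) := NormedAlgebra.restrictScalars ℚ ℂ (Op N)
  have h : Continuous (NormedSpace.exp : Op N → Op N) := NormedSpace.exp_continuous
  fun_prop

theorem partialPeriod_zero {N : ℕ} (p : Params N) : partialPeriod p 0 = 1 := by
  simp [partialPeriod]

theorem propagator_zero {N : ℕ} (p : Params N) : propagator p 0 = 1 := by
  simp [propagator, partialPeriod_zero]

theorem propagator_eq {N : ℕ} (p : Params N) (n : ℕ) {t : ℝ} (h0 : (n : ℝ) ≤ t)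
    (h1 : t ≤ n + 1) : propagator p t = partialPeriod p (t - n) * floquetOp p ^ n := by
  rcases h1.lt_or_eq with h | h
  · have hfl : ⌊t⌋₊ = n := by
      rw [Nat.floor_eq_iff (le_trans n.cast_nonneg h0)]; exact ⟨h0, h⟩
    have hfz : ⌊t⌋ = (n : ℤ) := by
      rw [Int.floor_eq_iff]; exact ⟨by exact_mod_cast h0, by exact_mod_cast h⟩
    simp [propagator, Int.fract, hfl, hfz]
  · have h' : t = ((n + 1 : ℕ) : ℝ) := by rw [h]; push_cast; ring
    rw [h', propagator, Int.fract_natCast, Nat.floor_natCast, partialPeriod_zero, one_mul, pow_succ']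
    congr 1
    rw [floquetOp]; congr 1; push_cast; ring

/-- The propagator is continuous in time. -/
theorem continuousOn_propagator {N : ℕ} (p : Params N) :
    ContinuousOn (propagator p) (Set.Ici 0) := by
  have hloc : LocallyFinite fun n : ℕ => Set.Icc (n : ℝ) (n + 1) := by
    intro x
    refine ⟨Metric.ball x 1, Metric.ball_mem_nhds x one_pos,
      (Set.finite_Iic ⌊x + 1⌋₊).subset ?_⟩
    rintro n ⟨y, hy, hyx⟩
    rw [Metric.mem_ball, Real.dist_eq, abs_lt] at hyx
    exact Nat.le_floor (by linarith [hy.1])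
  refine (hloc.continuousOn_iUnion (fun _ => isClosed_Icc) fun n => ?_).mono ?_
  · have hc : Continuous fun t : ℝ => partialPeriod p (t - n) * floquetOp p ^ n :=
      ((continuous_partialPeriod p).comp (continuous_sub_right _)).mul continuous_const
    exact hc.continuousOn.congr fun t ht => propagator_eq p n ht.1 ht.2
  · intro t ht
    exact Set.mem_iUnion.2 ⟨⌊t⌋₊, Nat.floor_le ht, (Nat.lt_floor_add_one t).le⟩

/-- The propagator solves the Schrödinger equation `i U'(t) = H(t) U(t)`, with the derivative
taken from the right (the Hamiltonian jumps at the half-integers). -/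
theorem hasDerivWithinAt_propagator {N : ℕ} (p : Params N) {t : ℝ} (ht : 0 ≤ t) :
    HasDerivWithinAt (propagator p) (-Complex.I • (hamiltonian p t * propagator p t))
      (Set.Ici t) t := by
  set n : ℕ := ⌊t⌋₊ with hn
  have h0 : (n : ℝ) ≤ t := Nat.floor_le ht
  have h1 : t < n + 1 := Nat.lt_floor_add_one t
  have hfr : Int.fract t = t - n := by
    have hfz : ⌊t⌋ = (n : ℤ) := by
      rw [Int.floor_eq_iff]; exact ⟨by exact_mod_cast h0, by exact_mod_cast h1⟩
    simp [Int.fract, hfz]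
  have hsub : HasDerivAt (fun s : ℝ => s - n) 1 t := (hasDerivAt_id t).sub_const _
  rw [propagator_eq p n h0 h1.le, hamiltonian, hfr]
  split_ifs with h
  · have hd : HasDerivAt
        (fun s : ℝ => NormedSpace.exp ((s - n) • (-Complex.I • H₁ p)) * floquetOp p ^ n)
        (((1 : ℝ) • ((-Complex.I • H₁ p) * NormedSpace.exp ((t - n) • (-Complex.I • H₁ p)))) *
          floquetOp p ^ n) t :=
      ((hasDerivAt_exp_smul_const' (𝕂 := ℝ) (-Complex.I • H₁ p) (t - n)).scomp t hsub).mul_const _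
    have hev : ∀ s, (n : ℝ) ≤ s → s < n + 1 / 2 → propagator p s =
        NormedSpace.exp ((s - n) • (-Complex.I • H₁ p)) * floquetOp p ^ n := by
      intro s hs hs'
      rw [propagator_eq p n hs (by linarith), partialPeriod, max_eq_right (by linarith),
        min_eq_left (by linarith)]
      simp
    have key := hd.hasDerivWithinAt (s := Set.Ici t)
    have key2 : HasDerivWithinAt (propagator p) _ (Set.Ici t) t :=
      key.congr_of_eventuallyEq (by
        filter_upwards [self_mem_nhdsWithin,
          mem_nhdsWithin_of_mem_nhds (Iio_mem_nhds (show t < n + 1 / 2 by linarith))] with s hs hs'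
        exact hev s (h0.trans hs) hs') (hev t h0 (by linarith))
    convert key2 using 1
    rw [partialPeriod, max_eq_right (by linarith), min_eq_left (by linarith)]
    simp [mul_assoc]
  · have h : (1 : ℝ) / 2 ≤ t - n := not_lt.1 h
    have hd : HasDerivAt
        (fun s : ℝ => NormedSpace.exp ((s - n - 1 / 2) • (-Complex.I • H₂ p)) *
          (NormedSpace.exp ((1 / 2 : ℝ) • (-Complex.I • H₁ p)) * floquetOp p ^ n))
        (((1 : ℝ) • ((-Complex.I • H₂ p) *
          NormedSpace.exp ((t - n - 1 / 2) • (-Complex.I • H₂ p)))) *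
          (NormedSpace.exp ((1 / 2 : ℝ) • (-Complex.I • H₁ p)) * floquetOp p ^ n)) t :=
      ((hasDerivAt_exp_smul_const' (𝕂 := ℝ) (-Complex.I • H₂ p) (t - n - 1 / 2)).scomp t
        (hsub.sub_const _)).mul_const _
    have hev : ∀ s, (n : ℝ) + 1 / 2 ≤ s → s < n + 1 → propagator p s =
        NormedSpace.exp ((s - n - 1 / 2) • (-Complex.I • H₂ p)) *
          (NormedSpace.exp ((1 / 2 : ℝ) • (-Complex.I • H₁ p)) * floquetOp p ^ n) := by
      intro s hs hs'
      rw [propagator_eq p n (by linarith) hs'.le, partialPeriod, max_eq_left (by linarith),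
        min_eq_right (by linarith), mul_assoc]
    have key := hd.hasDerivWithinAt (s := Set.Ici t)
    have key2 : HasDerivWithinAt (propagator p) _ (Set.Ici t) t :=
      key.congr_of_eventuallyEq (by
        filter_upwards [self_mem_nhdsWithin,
          mem_nhdsWithin_of_mem_nhds (Iio_mem_nhds h1)] with s hs hs'
        exact hev s ((by linarith : (n : ℝ) + 1 / 2 ≤ t).trans hs) hs') (hev t (by linarith) h1)
    convert key2 using 1
    rw [partialPeriod, max_eq_left (by linarith), min_eq_right (by linarith)]
    simp [mul_assoc]

end KickedIsing

end

open MeasureTheory Filter Topology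
open scoped Matrix Matrix.Norms.L2Operator Kronecker

noncomputable section

/-! Let `μ j` be the eigenvalues of the Floquet operator and `c j` the amplitudes of the initial
state in its eigenbasis. At time `m + x` the expectation value is the sum over `j, k` of `star (c j)
* B x j k * c k * (star (μ j) * μ k) ^ m`, where `B x` is the observable pulled back through the
fraction `x` of a period. The diagonal terms do not depend on `m`; they form the reference function.
If the ratios `star (μ j) * μ k` with `j ≠ k` are pairwise distinct, Parseval in mean turns the
time-averaged squared deviation into a sum of squares, which is at most `∑ ‖c j‖ ^ 4` because `‖B x‖
≤ 1`. A small inverse participation ratio therefore makes most periods good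
(`isApproxPeriodic_expectation`).

For any fixed unit vector, entangled or not, the fourth moment of its overlap with a random product
state is at most `3⁻ᴺ`: each qubit contributes a factor `1/3`. Summing over `2ᴺ` eigenvectors gives
mean participation ratio at most `(2/3)ᴺ`, and Markov's inequality gives the probability bound
(`haarProduct_participation_gt_le`).

It remains to see that for almost all parameters the ratios are distinct; this follows once the
products `μ j * μ k` over unordered pairs are distinct. The latter is the nonvanishing of a
discriminant `symDisc` that is polynomial in the Floquet operator, hence real-analytic in the
parameters, so a single good parameter point for each chain length suffices. The point is found by
adding one qubit at a time (`exists_isGeneric_coupling`). With the new bond switched off, the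
eigenvalues are `k i * μ a`, and for suitable one-qubit gates the only nontrivial coincidences come
from exchanging the system labels between the two factors. First-order perturbation theory in the
bond lifts them if `σᶻ` at the junction has distinct expectations in the old eigenvectors. This
second property must thus be carried along in the induction, which is the reason for the form of
`IsGeneric`; the bond also restores it, at first order, for the new end spin. -/

/-! ### Zero sets of real-analytic functions -/

/-- On the real line, a nonzero analytic function vanishes only on a null set. -/
theorem AnalyticOnNhd.volume_zeros_eq_zero {f : ℝ → ℂ} (hf : AnalyticOnNhd ℝ f Set.univ)
    {x₀ : ℝ} (h0 : f x₀ ≠ 0) : volume {x | f x = 0} = 0 := by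
  apply measure_null_of_locally_null
  intro x _
  have hx : ∀ᶠ z in 𝓝[≠] x, f z ≠ 0 := by
    rcases (hf x trivial).eventually_eq_zero_or_eventually_ne_zero with h | h
    · exact absurd (hf.eqOn_zero_of_preconnected_of_eventuallyEq_zero isPreconnected_univ
        (Set.mem_univ x) h (Set.mem_univ x₀)) h0
    · exact h
  rw [eventually_nhdsWithin_iff] at hx
  refine ⟨{z | z ≠ x → f z ≠ 0} ∩ {x | f x = 0},
    inter_mem (mem_nhdsWithin_of_mem_nhds hx) self_mem_nhdsWithin, ?_⟩
  refine measure_mono_null (t := {x}) ?_ (by simp)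
  rintro z ⟨h1, h2⟩
  by_contra h
  exact h1 h h2

/-- A nonzero real-analytic function on a finite-dimensional space is nonzero almost everywhere. -/
theorem AnalyticOnNhd.ae_ne_zero {E : Type*} [NormedAddCommGroup E] [NormedSpace ℝ E]
    [FiniteDimensional ℝ E] [MeasurableSpace E] [BorelSpace E] (μ : Measure E)
    [μ.IsAddHaarMeasure] {f : E → ℂ} (hf : AnalyticOnNhd ℝ f Set.univ) {x₀ : E} (h0 : f x₀ ≠ 0) :
    ∀ᵐ x ∂μ, f x ≠ 0 := by
  have key : ∀ᵐ x ∂μ, f (x₀ + x) ≠ 0 := by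
    rcases subsingleton_or_nontrivial E with hE | hE
    · exact Eventually.of_forall fun x => by rwa [Subsingleton.elim (x₀ + x) x₀]
    have hmeas : MeasurableSet {x : E | f (x₀ + x) = 0} := by
      have : Continuous fun x : E => f (x₀ + x) :=
        (continuousOn_univ.1 hf.continuousOn).comp (continuous_const.add continuous_id)
      exact (isClosed_singleton.preimage this).measurableSet
    -- Polar coordinates centred at `x₀`: along every ray the function is analytic in the radius and
    -- nonzero at radius `0`, so its zeros on the ray are null; Fubini assembles the rays.
    have hprod : (μ.toSphere.prod (Measure.volumeIoiPow (Module.finrank ℝ E - 1)))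
        {q | f (x₀ + (q.2 : ℝ) • (q.1 : E)) = 0} = 0 := by
      have hm : MeasurableSet {q : Metric.sphere (0 : E) 1 × Set.Ioi (0 : ℝ) |
          f (x₀ + (q.2 : ℝ) • (q.1 : E)) = 0} := by
        have : Continuous fun q : Metric.sphere (0 : E) 1 × Set.Ioi (0 : ℝ) =>
            f (x₀ + (q.2 : ℝ) • (q.1 : E)) :=
          (continuousOn_univ.1 hf.continuousOn).comp (by fun_prop)
        exact (isClosed_singleton.preimage this).measurableSet
      rw [Measure.measure_prod_null hm]
      refine Eventually.of_forall fun u => ?_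
      have hz : volume {r : ℝ | f (x₀ + r • (u : E)) = 0} = 0 := by
        refine AnalyticOnNhd.volume_zeros_eq_zero (f := fun r : ℝ => f (x₀ + r • (u : E)))
          (x₀ := 0) ?_ (by simpa using h0)
        exact hf.comp (f := fun r : ℝ => x₀ + r • (u : E))
          (fun r _ => by fun_prop) (fun _ _ => trivial)
      refine (withDensity_absolutelyContinuous _ _) ?_
      rw [comap_subtype_coe_apply measurableSet_Ioi]
      refine measure_mono_null ?_ hz
      rintro _ ⟨r, hr, rfl⟩
      exact hr
    have hmp := μ.measurePreserving_homeomorphUnitSphereProd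
    rw [ae_iff]
    simp only [not_not]
    have h1 : (μ.comap ((↑) : ({0}ᶜ : Set E) → E)) {x | f (x₀ + x) = 0} = 0 := by
      rw [← hmp.measure_preimage_equiv (f := (homeomorphUnitSphereProd E).toMeasurableEquiv)] at hprod
      convert hprod using 2
      ext x
      have hx : (‖(x : E)‖ : ℝ) ≠ 0 := norm_ne_zero_iff.2 x.2
      simp [smul_smul, mul_inv_cancel₀ hx]
    rw [comap_subtype_coe_apply (measurableSet_singleton _).compl] at h1
    have h2 : {x : E | f (x₀ + x) = 0} ⊆
        ((↑) : ({0}ᶜ : Set E) → E) '' {x | f (x₀ + x) = 0} := by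
      intro x hx
      refine ⟨⟨x, ?_⟩, hx, rfl⟩
      rintro rfl
      exact h0 (by simpa using hx)
    exact measure_mono_null h2 h1
  have := (measurePreserving_add_left μ (-x₀)).quasiMeasurePreserving.ae key
  simpa using this

/-! ### Diagonalization of unitary matrices -/

/-- Spectral theorem for unitary matrices. -/
theorem Matrix.exists_diagonalization_of_mem_unitaryGroup {ι : Type*} [Fintype ι] [DecidableEq ι]
    {U : Matrix ι ι ℂ} (hU : U ∈ Matrix.unitaryGroup ι ℂ) :
    ∃ W ∈ Matrix.unitaryGroup ι ℂ, ∃ μ : ι → ℂ, U * W = W * Matrix.diagonal μ := by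
  classical
  -- The Hermitian matrices `A = U + Uᴴ` and `B = i (U - Uᴴ)` commute and `U = (A - i B) / 2`, so a
  -- joint orthonormal eigenbasis of `A` and `B` diagonalizes `U`.
  have hA : (U + Uᴴ).IsHermitian := by
    rw [Matrix.IsHermitian, Matrix.conjTranspose_add, Matrix.conjTranspose_conjTranspose, add_comm]
  have hB : (Complex.I • (U - Uᴴ)).IsHermitian := by
    rw [Matrix.IsHermitian, Matrix.conjTranspose_smul, Matrix.conjTranspose_sub,
      Matrix.conjTranspose_conjTranspose]
    simp only [RCLike.star_def, Complex.conj_I, neg_smul, ← smul_neg, neg_sub]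
  have hUU : U * Uᴴ = Uᴴ * U := by
    rw [← Matrix.star_eq_conjTranspose, (Matrix.mem_unitaryGroup_iff).1 hU,
      (Matrix.mem_unitaryGroup_iff').1 hU]
  have hAB : Commute (U + Uᴴ) (Complex.I • (U - Uᴴ)) := by
    rw [Commute, SemiconjBy, Matrix.mul_smul, Matrix.smul_mul]
    congr 1
    simp only [Matrix.add_mul, Matrix.mul_sub, Matrix.sub_mul, Matrix.mul_add, hUU]
    abel
  set TA := Matrix.toEuclideanLin (U + Uᴴ) with hTA
  set TB := Matrix.toEuclideanLin (Complex.I • (U - Uᴴ)) with hTB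
  have hAs : TA.IsSymmetric := Matrix.isSymmetric_toEuclideanLin_iff.2 hA
  have hBs : TB.IsSymmetric := Matrix.isSymmetric_toEuclideanLin_iff.2 hB
  have hcomm : Commute TA TB := by
    ext1 v
    simp only [Module.End.mul_apply, hTA, hTB, Matrix.toLpLin_apply, Matrix.mulVec_mulVec]
    rw [hAB.eq]
  have hint := LinearMap.IsSymmetric.directSum_isInternal_of_commute hAs hBs hcomm
  have horth := LinearMap.IsSymmetric.orthogonalFamily_eigenspace_inf_eigenspace hAs hBs
  let v := fun i : ℂ × ℂ => stdOrthonormalBasis ℂ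
    (Module.End.eigenspace TA i.2 ⊓ Module.End.eigenspace TB i.1 : Submodule ℂ (EuclideanSpace ℂ ι))
  let b := hint.collectedBasis fun i => (v i).toBasis
  have hb : Orthonormal ℂ b := by
    simpa [b] using horth.orthonormal_sigma_orthonormal fun i => (v i).orthonormal
  have := FiniteDimensional.fintypeBasisIndex b
  have hcard : Fintype.card (Σ i : ℂ × ℂ, Fin (Module.finrank ℂ
      (Module.End.eigenspace TA i.2 ⊓ Module.End.eigenspace TB i.1 :
        Submodule ℂ (EuclideanSpace ℂ ι)))) = Fintype.card ι := by
    rw [← Module.finrank_eq_card_basis b, finrank_euclideanSpace]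
  let e := Fintype.equivOfCardEq hcard
  have hw : Orthonormal ℂ (fun j : ι => b (e.symm j)) := hb.comp _ e.symm.injective
  refine ⟨Matrix.of fun s j => b (e.symm j) s, ?_,
    fun j => ((e.symm j).1.2 - Complex.I * (e.symm j).1.1) / 2, ?_⟩
  · rw [Matrix.mem_unitaryGroup_iff']
    ext j k
    have := (orthonormal_iff_ite.1 hw) j k
    rw [Matrix.one_apply, ← this]
    simp [Matrix.mul_apply, PiLp.inner_apply, mul_comm]
  · ext s j
    rw [Matrix.mul_diagonal]
    have hmem := hint.collectedBasis_mem (fun i => (v i).toBasis) (e.symm j)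
    obtain ⟨h1, h2⟩ := Submodule.mem_inf.1 hmem
    rw [Module.End.mem_eigenspace_iff] at h1 h2
    have h1 := congrArg (fun w : EuclideanSpace ℂ ι => w s) h1
    have h2 := congrArg (fun w : EuclideanSpace ℂ ι => w s) h2
    change TA (b (e.symm j)) s = (_ • b (e.symm j)) s at h1
    change TB (b (e.symm j)) s = (_ • b (e.symm j)) s at h2
    simp only [hTA, hTB, Matrix.toLpLin_apply, Matrix.add_mulVec, Matrix.smul_mulVec,
      Matrix.sub_mulVec, PiLp.smul_apply, Pi.add_apply, Pi.smul_apply, Pi.sub_apply,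
      smul_eq_mul] at h1 h2
    have h3 : (U * Matrix.of fun s j => b (e.symm j) s) s j = (U *ᵥ (b (e.symm j))) s := rfl
    rw [h3, Matrix.of_apply]
    linear_combination (1 / 2) * h1 - Complex.I / 2 * h2 +
      (1 / 2) * ((U *ᵥ (b (e.symm j))) s - (Uᴴ *ᵥ (b (e.symm j))) s) * Complex.I_sq

/-! ### Coincidences of eigenvalue products and their discriminant -/

/-- The only coincidences between products of two entries of `μ` are the trivial ones. -/
def HasDistinctProducts {ι : Type*} (μ : ι → ℂ) : Prop :=
  ∀ j k l m, μ j * μ k = μ l * μ m → (j = l ∧ k = m) ∨ (j = m ∧ k = l)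

theorem HasDistinctProducts.injective {ι : Type*} {μ : ι → ℂ} (h : HasDistinctProducts μ) :
    Function.Injective μ := by
  intro j k hjk
  rcases h j j k j (by rw [hjk]) with h | h
  · exact h.1
  · exact h.2

/-- Passing to unordered pairs turns the condition into injectivity of one finite family, to which
the Vandermonde criterion applies. -/
theorem hasDistinctProducts_iff_injective {ι : Type*} {μ : ι → ℂ} :
    HasDistinctProducts μ ↔ Function.Injective fun z : Sym2 ι => (z.map μ).mul := by
  constructor
  · intro h z w
    induction z with | _ j k
    induction w with | _ l m
    intro hzw
    exact Sym2.eq_iff.2 (h j k l m (by simpa using hzw))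
  · intro h j k l m hjk
    exact Sym2.eq_iff.1 (@h s(j, k) s(l, m) (by simpa using hjk))

/-- An unordered pair of distinct elements comes from two ordered pairs, a diagonal one from a
single pair; the extra diagonal sum makes up the difference. This is what expresses power sums over
unordered pairs by traces of powers of `U`. -/
theorem Sym2.two_mul_sum {ι : Type*} [Fintype ι] [DecidableEq ι] (f : Sym2 ι → ℂ) :
    2 * ∑ z, f z = (∑ j, ∑ k, f s(j, k)) + ∑ j, f s(j, j) := by
  have h1 : ∑ j, ∑ k, f s(j, k) =
      ∑ z : Sym2 ι, ∑ p ∈ (Finset.univ : Finset (ι × ι)).filter (fun p => s(p.1, p.2) = z),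
        f z := by
    rw [← Fintype.sum_prod_type', ← Finset.sum_fiberwise (s := Finset.univ)
      (g := fun p : ι × ι => s(p.1, p.2))]
    refine Finset.sum_congr rfl fun z _ => Finset.sum_congr rfl fun p hp => ?_
    rw [(Finset.mem_filter.1 hp).2]
  have h2 : ∑ j, f s(j, j) =
      ∑ z : Sym2 ι, ∑ j ∈ (Finset.univ : Finset ι).filter (fun j => s(j, j) = z), f z := by
    rw [← Finset.sum_fiberwise (s := Finset.univ) (g := fun j : ι => s(j, j))]
    refine Finset.sum_congr rfl fun z _ => Finset.sum_congr rfl fun p hp => ?_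
    rw [(Finset.mem_filter.1 hp).2]
  rw [h1, h2, ← Finset.sum_add_distrib, Finset.mul_sum]
  refine Finset.sum_congr rfl fun z _ => ?_
  rw [Finset.sum_const, Finset.sum_const, ← add_smul, nsmul_eq_mul]
  congr 1
  induction z with | _ a b
  by_cases hab : a = b
  · subst hab
    have e1 : (Finset.univ : Finset (ι × ι)).filter (fun p => s(p.1, p.2) = s(a, a)) = {(a, a)} := by
      ext ⟨x, y⟩; simp
    have e2 : (Finset.univ : Finset ι).filter (fun j => s(j, j) = s(a, a)) = {a} := by
      ext x; simp
    rw [e1, e2]; norm_num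
  · have e1 : (Finset.univ : Finset (ι × ι)).filter (fun p => s(p.1, p.2) = s(a, b)) =
        {(a, b), (b, a)} := by
      ext ⟨x, y⟩; simp
    have e2 : (Finset.univ : Finset ι).filter (fun j => s(j, j) = s(a, b)) = ∅ := by
      ext x
      simpa using ⟨fun h h' => hab (h.symm.trans h'), fun h h' => hab (h'.symm.trans h)⟩
    rw [e1, e2, Finset.card_pair (by simp [hab])]; norm_num

/-- The `n`-th power sum of the products `μ_j μ_k`, `j ≤ k`, of the eigenvalues of `U`. -/
def symMoment {ι : Type*} [Fintype ι] [DecidableEq ι] (U : Matrix ι ι ℂ) (n : ℕ) : ℂ :=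
  ((U ^ n).trace ^ 2 + (U ^ (2 * n)).trace) / 2

/-- The discriminant of the family of products `μ_j μ_k`, `j ≤ k`, of the eigenvalues of `U`, as a
Hankel determinant. -/
def symDisc {ι : Type*} [Fintype ι] [DecidableEq ι] (U : Matrix ι ι ℂ) : ℂ :=
  (Matrix.of fun r s : Fin (Fintype.card (Sym2 ι)) => symMoment U (r + s)).det

theorem Matrix.trace_pow_of_diagonalization {ι : Type*} [Fintype ι] [DecidableEq ι]
    {U W : Matrix ι ι ℂ} {μ : ι → ℂ} (hW : W ∈ Matrix.unitaryGroup ι ℂ)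
    (h : U * W = W * Matrix.diagonal μ) (n : ℕ) : (U ^ n).trace = ∑ j, μ j ^ n := by
  have hn : U ^ n * W = W * Matrix.diagonal (fun j => μ j ^ n) := by
    have := (SemiconjBy.pow_right (a := W) (x := Matrix.diagonal μ) (y := U) h.symm n).eq
    rw [← this, Matrix.diagonal_pow]; rfl
  have hWW := (Matrix.mem_unitaryGroup_iff).1 hW
  have hWW' := (Matrix.mem_unitaryGroup_iff').1 hW
  calc (U ^ n).trace = (U ^ n * (W * star W)).trace := by rw [hWW, mul_one]
    _ = (star W * (W * Matrix.diagonal (fun j => μ j ^ n))).trace := by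
      rw [← mul_assoc, hn, Matrix.trace_mul_comm]
    _ = ∑ j, μ j ^ n := by rw [← mul_assoc, hWW', one_mul, Matrix.trace_diagonal]

/-- The Hankel matrix of power sums factors as `Vᵀ * V` with `V` the Vandermonde matrix of the
products, so its determinant is the square of the Vandermonde determinant. The gain is that
`symDisc` depends polynomially on the entries of `U`, whereas individual eigenvalues need not depend
analytically on them. -/
theorem symDisc_ne_zero_iff {ι : Type*} [Fintype ι] [DecidableEq ι]
    {U W : Matrix ι ι ℂ} {μ : ι → ℂ} (hW : W ∈ Matrix.unitaryGroup ι ℂ)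
    (h : U * W = W * Matrix.diagonal μ) : symDisc U ≠ 0 ↔ HasDistinctProducts μ := by
  let e := (Fintype.equivFin (Sym2 ι)).symm
  let ν : Fin (Fintype.card (Sym2 ι)) → ℂ := fun i => ((e i).map μ).mul
  have hm : ∀ n, symMoment U n = ∑ i, ν i ^ n := by
    intro n
    have h2 := Sym2.two_mul_sum (fun z : Sym2 ι => (z.map μ).mul ^ n)
    simp only [Sym2.map_mk, Sym2.mul_mk] at h2
    have h3 : ∑ i, ν i ^ n = ∑ z : Sym2 ι, (z.map μ).mul ^ n :=
      Equiv.sum_comp e (fun z : Sym2 ι => (z.map μ).mul ^ n)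
    rw [h3, symMoment, Matrix.trace_pow_of_diagonalization hW h,
      Matrix.trace_pow_of_diagonalization hW h, div_eq_iff two_ne_zero, mul_comm _ (2 : ℂ), h2]
    congr 1
    · rw [sq, Finset.sum_mul_sum]; simp only [mul_pow]
    · exact Finset.sum_congr rfl fun j _ => by ring
  have hH : (Matrix.of fun r s : Fin (Fintype.card (Sym2 ι)) => symMoment U (r + s)) =
      (Matrix.vandermonde ν)ᵀ * Matrix.vandermonde ν := by
    ext r s
    simp [Matrix.mul_apply, Matrix.vandermonde_apply, hm, pow_add]
  rw [symDisc, hH, Matrix.det_mul, Matrix.det_transpose, mul_self_ne_zero,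
    Matrix.det_vandermonde_ne_zero_iff, hasDistinctProducts_iff_injective]
  constructor
  · intro hν z w hzw
    have := @hν (e.symm z) (e.symm w) (by simpa [ν] using hzw)
    exact e.symm.injective this
  · intro hν z w hzw
    exact e.injective (hν hzw)

theorem analyticOnNhd_symMoment {ι : Type*} [Fintype ι] [DecidableEq ι] (n : ℕ) :
    AnalyticOnNhd ℝ (fun U : Matrix ι ι ℂ => symMoment U n) Set.univ := by
  have htr : ∀ n, AnalyticOnNhd ℝ (fun U : Matrix ι ι ℂ => (U ^ n).trace) Set.univ := by
    intro n U _
    have h1 : AnalyticAt ℝ (fun U : Matrix ι ι ℂ => U ^ n) U := analyticAt_id.pow n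
    have h2 := ((Matrix.traceLinearMap ι ℝ ℂ).toContinuousLinearMap).analyticAt (U ^ n)
    exact AnalyticAt.fun_comp (g := fun V : Matrix ι ι ℂ => V.trace) h2 h1
  intro U _
  unfold symMoment
  exact (((htr n U trivial).pow 2).add (htr _ U trivial)).div analyticAt_const two_ne_zero

theorem analyticOnNhd_symDisc {ι : Type*} [Fintype ι] [DecidableEq ι] :
    AnalyticOnNhd ℝ (symDisc : Matrix ι ι ℂ → ℂ) Set.univ := by
  intro U _
  unfold symDisc
  simp only [Matrix.det_apply, Matrix.of_apply]
  refine Finset.analyticAt_fun_sum _ fun σ _ => ?_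
  simp only [Units.smul_def, zsmul_eq_mul]
  refine analyticAt_const.mul (Finset.analyticAt_fun_prod _ fun i _ => ?_)
  exact analyticOnNhd_symMoment _ U trivial

/-! ### Unitarity and analyticity of the Floquet operator -/

namespace KickedIsing

theorem isHermitian_onSite {N : ℕ} (l : Fin N) {M : Matrix (Fin 2) (Fin 2) ℂ}
    (hM : M.IsHermitian) : (onSite l M).IsHermitian := by
  ext s s'
  have : (∀ k, k ≠ l → s' k = s k) ↔ ∀ k, k ≠ l → s k = s' k :=
    forall_congr' fun k => imp_congr_right fun _ => eq_comm
  simp only [onSite, Matrix.conjTranspose_apply, Matrix.of_apply, this]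
  split_ifs
  · exact hM.apply _ _
  · simp

theorem isHermitian_pauliX : pauliX.IsHermitian := by
  ext i j; fin_cases i <;> fin_cases j <;> simp [pauliX]

/-- The eigenvalue `±1` of `σᶻ` on a computational basis state. -/
def zval (b : Fin 2) : ℝ := if b = 0 then 1 else -1

theorem pauliZ_apply (b b' : Fin 2) : pauliZ b b' = if b = b' then (zval b : ℂ) else 0 := by
  fin_cases b <;> fin_cases b' <;> simp [pauliZ, zval]

theorem onSite_pauliZ {N : ℕ} (l : Fin N) :
    onSite l pauliZ = Matrix.diagonal fun s : Basis N => (zval (s l) : ℂ) := by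
  ext s s'
  simp only [onSite, Matrix.of_apply, Matrix.diagonal_apply, pauliZ_apply]
  by_cases h : s = s'
  · simp [h]
  · rw [if_neg h]
    split_ifs with h1 h2
    · exact absurd (funext fun k => if hk : k = l then hk ▸ h2 else h1 k hk) h
    · rfl
    · rfl

/-- The energies of the diagonal Hamiltonian `H'₁`. -/
def energy {N : ℕ} (p : Params N) (s : Basis N) : ℝ :=
  ∑ l : Fin N, p.2.1 l * zval (s l) +
    ∑ l : Fin (N - 1), p.2.2 l * (zval (s (bondLeft l)) * zval (s (bondRight l)))

theorem H₁_eq {N : ℕ} (p : Params N) :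
    H₁ p = Matrix.diagonal fun s => (energy p s : ℂ) := by
  ext s s'
  simp only [H₁, onSite_pauliZ, Matrix.diagonal_mul_diagonal, Matrix.add_apply, Matrix.sum_apply,
    Matrix.smul_apply, Matrix.diagonal_apply, energy]
  split_ifs with h
  · simp
  · simp

theorem isHermitian_H₁ {N : ℕ} (p : Params N) : (H₁ p).IsHermitian := by
  rw [H₁_eq]
  exact Matrix.isHermitian_diagonal_of_self_adjoint _ (by ext s; simp)

theorem isHermitian_H₂ {N : ℕ} (p : Params N) : (H₂ p).IsHermitian := by
  rw [Matrix.IsHermitian, H₂, Matrix.conjTranspose_sum]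
  refine Finset.sum_congr rfl fun l _ => ?_
  rw [Matrix.conjTranspose_smul, (isHermitian_onSite l isHermitian_pauliX).eq]
  simp

theorem exp_smul_mem_unitary {N : ℕ} {H : Op N} (hH : H.IsHermitian) (t : ℝ) :
    NormedSpace.exp (t • (-Complex.I • H)) ∈ Matrix.unitaryGroup (Basis N) ℂ := by
  let _ : NormedAlgebra ℚ (Op N) := NormedAlgebra.restrictScalars ℚ ℂ (Op N)
  refine NormedSpace.exp_mem_unitary_of_mem_skewAdjoint ?_
  rw [skewAdjoint.mem_iff, star_smul, star_smul, Matrix.star_eq_conjTranspose, hH.eq]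
  simp

theorem partialPeriod_mem_unitary {N : ℕ} (p : Params N) (x : ℝ) :
    partialPeriod p x ∈ Matrix.unitaryGroup (Basis N) ℂ :=
  mul_mem (exp_smul_mem_unitary (isHermitian_H₂ p) _) (exp_smul_mem_unitary (isHermitian_H₁ p) _)

theorem floquetOp_mem_unitary {N : ℕ} (p : Params N) :
    floquetOp p ∈ Matrix.unitaryGroup (Basis N) ℂ :=
  partialPeriod_mem_unitary p 1

theorem analyticOnNhd_floquetOp {N : ℕ} :
    AnalyticOnNhd ℝ (floquetOp : Params N → Op N) Set.univ := by
  intro p _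
  let _ : NormedAlgebra ℚ (Op N) := NormedAlgebra.restrictScalars ℚ ℂ (Op N)
  have hx : ∀ l, AnalyticAt ℝ (fun p : Params N => (p.1 l : ℂ)) p := fun l =>
    (Complex.ofRealCLM ∘L ContinuousLinearMap.proj l ∘L ContinuousLinearMap.fst ℝ _ _).analyticAt p
  have hz : ∀ l, AnalyticAt ℝ (fun p : Params N => (p.2.1 l : ℂ)) p := fun l =>
    (Complex.ofRealCLM ∘L ContinuousLinearMap.proj l ∘L ContinuousLinearMap.fst ℝ _ _ ∘L
      ContinuousLinearMap.snd ℝ _ _).analyticAt p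
  have hJ : ∀ l, AnalyticAt ℝ (fun p : Params N => (p.2.2 l : ℂ)) p := fun l =>
    (Complex.ofRealCLM ∘L ContinuousLinearMap.proj l ∘L ContinuousLinearMap.snd ℝ _ _ ∘L
      ContinuousLinearMap.snd ℝ _ _).analyticAt p
  have h1 : AnalyticAt ℝ (H₁ : Params N → Op N) p := by
    unfold H₁
    exact (Finset.analyticAt_fun_sum _ fun l _ => (hz l).smul analyticAt_const).add
      (Finset.analyticAt_fun_sum _ fun l _ => (hJ l).smul analyticAt_const)
  have h2 : AnalyticAt ℝ (H₂ : Params N → Op N) p := by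
    unfold H₂
    exact Finset.analyticAt_fun_sum _ fun l _ => (hx l).smul analyticAt_const
  have hexp : ∀ A : Op N, AnalyticAt ℝ (NormedSpace.exp : Op N → Op N) A :=
    fun A => NormedSpace.exp_analytic (𝕂 := ℝ) A
  unfold floquetOp partialPeriod
  refine AnalyticAt.mul ?_ ?_
  · exact AnalyticAt.fun_comp (g := NormedSpace.exp) (hexp _)
      (analyticAt_const.fun_smul (analyticAt_const.fun_smul h2))
  · exact AnalyticAt.fun_comp (g := NormedSpace.exp) (hexp _)
      (analyticAt_const.fun_smul (analyticAt_const.fun_smul h1))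

/-- If some parameters give a Floquet operator with nonvanishing `symDisc`, almost all do. -/
theorem ae_symDisc_floquetOp_ne_zero {N : ℕ} {p₀ : Params N} (h : symDisc (floquetOp p₀) ≠ 0) :
    ∀ᵐ p : Params N, symDisc (floquetOp p) ≠ 0 := by
  have hvol : (volume : Measure (Params N)).IsAddHaarMeasure :=
    have := Measure.prod.instIsAddHaarMeasure (volume : Measure (Fin N → ℝ))
      (volume : Measure (Fin (N - 1) → ℝ))
    Measure.prod.instIsAddHaarMeasure (volume : Measure (Fin N → ℝ))
      ((volume : Measure (Fin N → ℝ)).prod (volume : Measure (Fin (N - 1) → ℝ)))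
  have hf : AnalyticOnNhd ℝ (fun p : Params N => symDisc (floquetOp p)) Set.univ := fun p _ =>
    AnalyticAt.fun_comp (g := symDisc) (analyticOnNhd_symDisc _ trivial)
      (analyticOnNhd_floquetOp p trivial)
  exact hf.ae_ne_zero volume h

/-! ### Moments of Haar-random product states -/

open Pointwise in
/-- A linear isometry of `ℂ²` preserves the Haar measure on qubit states. -/
theorem integral_haarQubit_comp
    (T : EuclideanSpace ℂ (Fin 2) ≃ₗᵢ[ℝ] EuclideanSpace ℂ (Fin 2))
    (F : EuclideanSpace ℂ (Fin 2) → ℝ) :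
    ∫ φ : QubitState, F (T φ) ∂haarQubit = ∫ φ : QubitState, F φ ∂haarQubit := by
  have hmaps : ∀ S : EuclideanSpace ℂ (Fin 2) ≃ₗᵢ[ℝ] EuclideanSpace ℂ (Fin 2),
      ∀ φ : QubitState, S φ ∈ Metric.sphere (0 : EuclideanSpace ℂ (Fin 2)) 1 := by
    intro S φ
    simp
  let τ : QubitState ≃ₜ QubitState :=
    { toFun := fun φ => ⟨T φ, hmaps T φ⟩
      invFun := fun φ => ⟨T.symm φ, hmaps T.symm φ⟩
      left_inv := fun φ => by ext1; simp
      right_inv := fun φ => by ext1; simp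
      continuous_toFun := by fun_prop
      continuous_invFun := by fun_prop }
  have hpres : MeasurePreserving τ
      (volume : Measure (EuclideanSpace ℂ (Fin 2))).toSphere
      (volume : Measure (EuclideanSpace ℂ (Fin 2))).toSphere := by
    refine ⟨τ.measurable, ?_⟩
    ext s hs
    rw [Measure.map_apply τ.measurable hs, Measure.toSphere_apply' _ hs,
      Measure.toSphere_apply' _ (τ.measurable hs)]
    congr 1
    -- The surface measure of a set is, up to the dimension factor, the volume of the cone over it.
    -- The isometry maps cones to cones and preserves volume.
    have : (Set.Ioo (0 : ℝ) 1 • ((↑) '' (τ ⁻¹' s) : Set (EuclideanSpace ℂ (Fin 2)))) =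
        T ⁻¹' (Set.Ioo (0 : ℝ) 1 • ((↑) '' s)) := by
      ext x
      simp only [Set.mem_smul, Set.mem_image, Set.mem_preimage]
      constructor
      · rintro ⟨r, hr, _, ⟨φ, hφ, rfl⟩, rfl⟩
        exact ⟨r, hr, T φ, ⟨τ φ, hφ, rfl⟩, by simp⟩
      · rintro ⟨r, hr, _, ⟨φ, hφ, rfl⟩, hx⟩
        refine ⟨r, hr, T.symm φ, ⟨τ.symm φ, ?_, rfl⟩, ?_⟩
        · simpa using hφ
        · rw [← map_smul, hx]; simp
    rw [this]
    exact T.measurePreserving.measure_preimage_emb T.toHomeomorph.measurableEmbedding _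
  have h2 : MeasurePreserving τ haarQubit haarQubit := by
    unfold haarQubit
    exact hpres.smul_measure _
  exact h2.integral_comp τ.measurableEmbedding (fun φ : QubitState => F φ)

theorem integrable_haarQubit {F : QubitState → ℝ} (hF : Continuous F) :
    Integrable F haarQubit :=
  hF.integrable_of_hasCompactSupport (HasCompactSupport.of_compactSpace F)

/-- The isometry of `ℂ²` given by a unitary `2 × 2` matrix. -/
theorem exists_isometry (a b c d : ℂ) (h1 : ‖a‖ ^ 2 + ‖c‖ ^ 2 = 1) (h2 : ‖b‖ ^ 2 + ‖d‖ ^ 2 = 1)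
    (h3 : star a * b + star c * d = 0) :
    ∃ T : EuclideanSpace ℂ (Fin 2) ≃ₗᵢ[ℝ] EuclideanSpace ℂ (Fin 2),
      ∀ x, T x 0 = a * x 0 + b * x 1 ∧ T x 1 = c * x 0 + d * x 1 := by
  let L : EuclideanSpace ℂ (Fin 2) →ₗ[ℝ] EuclideanSpace ℂ (Fin 2) :=
    { toFun := fun x => !₂[a * x 0 + b * x 1, c * x 0 + d * x 1]
      map_add' := fun x y => by
        ext i; fin_cases i <;> simp <;> ring
      map_smul' := fun r x => by
        ext i; fin_cases i <;> simp <;> ring }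
  have hL : ∀ x, ‖L x‖ = ‖x‖ := by
    intro x
    have : ‖L x‖ ^ 2 = ‖x‖ ^ 2 := by
      rw [EuclideanSpace.norm_sq_eq, EuclideanSpace.norm_sq_eq, Fin.sum_univ_two, Fin.sum_univ_two]
      have e0 : L x 0 = a * x 0 + b * x 1 := rfl
      have e1 : L x 1 = c * x 0 + d * x 1 := rfl
      rw [e0, e1]
      rw [← Complex.ofReal_inj]
      rw [← Complex.ofReal_inj] at h1 h2
      push_cast at h1 h2 ⊢
      simp only [← Complex.conj_mul', map_add, map_mul] at h1 h2 ⊢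
      have h3' : (starRingEnd ℂ) a * b + (starRingEnd ℂ) c * d = 0 := h3
      have h4 := congrArg (starRingEnd ℂ) h3'
      simp only [map_add, map_mul, Complex.conj_conj, map_zero] at h4
      linear_combination (starRingEnd ℂ (x 0) * x 0) * h1 + (starRingEnd ℂ (x 1) * x 1) * h2 +
        (starRingEnd ℂ (x 0) * x 1) * h3' + (x 0 * starRingEnd ℂ (x 1)) * h4
    exact (sq_eq_sq₀ (norm_nonneg _) (norm_nonneg _)).1 this
  let T : EuclideanSpace ℂ (Fin 2) →ₗᵢ[ℝ] EuclideanSpace ℂ (Fin 2) := ⟨L, hL⟩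
  exact ⟨T.toLinearIsometryEquiv rfl, fun x => ⟨rfl, rfl⟩⟩

/-- The second moment of the expectation value of a Hermitian `2 × 2` matrix, with the
interference terms averaged out. -/
theorem integral_quadratic_sq (a b : ℝ) (g : ℂ) :
    ∫ φ : QubitState, (a * ‖φ.1 0‖ ^ 2 + b * ‖φ.1 1‖ ^ 2 +
        2 * (star (φ.1 0) * φ.1 1 * g).re) ^ 2 ∂haarQubit =
      ∫ φ : QubitState, ((a * ‖φ.1 0‖ ^ 2 + b * ‖φ.1 1‖ ^ 2) ^ 2 +
        2 * ‖g‖ ^ 2 * (‖φ.1 0‖ ^ 2 * ‖φ.1 1‖ ^ 2)) ∂haarQubit := by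
  -- Invariance under `diag(1, u)` multiplies the interference term `y` by `u`. Averaging over `u =
  -- 1, -1, i, -i` removes the part linear in `y` and replaces `(2 Re y)²` by `2 |y|²`.
  have key : ∀ u : ℂ, ‖u‖ = 1 →
      ∫ φ : QubitState, (a * ‖φ.1 0‖ ^ 2 + b * ‖φ.1 1‖ ^ 2 +
        2 * (star (φ.1 0) * φ.1 1 * g).re) ^ 2 ∂haarQubit =
      ∫ φ : QubitState, (a * ‖φ.1 0‖ ^ 2 + b * ‖φ.1 1‖ ^ 2 +
        2 * (u * (star (φ.1 0) * φ.1 1 * g)).re) ^ 2 ∂haarQubit := by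
    intro u hu
    obtain ⟨T, hT⟩ := exists_isometry 1 0 0 u (by simp) (by simp [hu]) (by simp)
    rw [← integral_haarQubit_comp T (fun x => (a * ‖x 0‖ ^ 2 + b * ‖x 1‖ ^ 2 +
        2 * (star (x 0) * x 1 * g).re) ^ 2)]
    refine integral_congr_ae (Eventually.of_forall fun φ => ?_)
    simp only [(hT _).1, (hT _).2]
    simp only [one_mul, zero_mul, add_zero, zero_add, norm_mul, hu]
    congr 4
    ring_nf
  have hc : ∀ u : ℂ, Integrable (fun φ : QubitState => (a * ‖φ.1 0‖ ^ 2 + b * ‖φ.1 1‖ ^ 2 +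
        2 * (u * (star (φ.1 0) * φ.1 1 * g)).re) ^ 2) haarQubit := fun u =>
    integrable_haarQubit (by fun_prop)
  have e1 := key (-1) (by simp)
  have e2 := key Complex.I (by simp)
  have e3 := key (-Complex.I) (by simp)
  have e0 := key 1 (by simp)
  set X := ∫ φ : QubitState, (a * ‖φ.1 0‖ ^ 2 + b * ‖φ.1 1‖ ^ 2 +
        2 * (star (φ.1 0) * φ.1 1 * g).re) ^ 2 ∂haarQubit with hX
  have : X = (1 / 4 : ℝ) * (X + X + (X + X)) := by ring
  rw [this]
  nth_rewrite 1 [e0]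
  nth_rewrite 1 [e1]
  nth_rewrite 1 [e2]
  rw [e3]
  rw [← integral_add (hc _) (hc _), ← integral_add (hc _) (hc _),
    ← integral_add ((hc _).fun_add (hc _)) ((hc _).fun_add (hc _)), ← integral_const_mul]
  refine integral_congr_ae (Eventually.of_forall fun φ => ?_)
  simp only []
  have hn : ‖star (φ.1 0) * φ.1 1 * g‖ ^ 2 = ‖g‖ ^ 2 * (‖φ.1 0‖ ^ 2 * ‖φ.1 1‖ ^ 2) := by
    rw [norm_mul, norm_mul, norm_star]; ring
  rw [mul_assoc 2, ← hn, ← Complex.normSq_eq_norm_sq (star (φ.1 0) * φ.1 1 * g), Complex.normSq_apply]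
  generalize star (φ.1 0) * φ.1 1 * g = y
  simp
  ring

theorem norm_sq_add_norm_sq (φ : QubitState) : ‖φ.1 0‖ ^ 2 + ‖φ.1 1‖ ^ 2 = 1 := by
  have h := EuclideanSpace.norm_sq_eq φ.1
  rw [Fin.sum_univ_two] at h
  rw [← h]
  simp

/-- Symmetry determines the moments without integrating over the sphere. The swap of coordinates
equates the two fourth moments `m`; squaring the normalization gives `2m + 2n = 1` for the mixed
moment `n`; the Hadamard rotation gives `m = (1 + 2n) / 4`. -/
theorem integral_norm_pow_four :
    ∫ φ : QubitState, ‖φ.1 0‖ ^ 4 ∂haarQubit = 1 / 3 ∧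
    ∫ φ : QubitState, ‖φ.1 1‖ ^ 4 ∂haarQubit = 1 / 3 ∧
    ∫ φ : QubitState, ‖φ.1 0‖ ^ 2 * ‖φ.1 1‖ ^ 2 ∂haarQubit = 1 / 6 := by
  have i0 : Integrable (fun φ : QubitState => ‖φ.1 0‖ ^ 4) haarQubit :=
    integrable_haarQubit (by fun_prop)
  have i1 : Integrable (fun φ : QubitState => ‖φ.1 1‖ ^ 4) haarQubit :=
    integrable_haarQubit (by fun_prop)
  have i2 : Integrable (fun φ : QubitState => ‖φ.1 0‖ ^ 2 * ‖φ.1 1‖ ^ 2) haarQubit :=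
    integrable_haarQubit (by fun_prop)
  have hswap : ∫ φ : QubitState, ‖φ.1 1‖ ^ 4 ∂haarQubit =
      ∫ φ : QubitState, ‖φ.1 0‖ ^ 4 ∂haarQubit := by
    obtain ⟨T, hT⟩ := exists_isometry 0 1 1 0 (by simp) (by simp) (by simp)
    rw [← integral_haarQubit_comp T (fun x => ‖x 0‖ ^ 4)]
    simp only [(hT _).1, zero_mul, one_mul, zero_add]
  have hone : (1 : ℝ) = ∫ φ : QubitState, ‖φ.1 0‖ ^ 4 ∂haarQubit +
      ∫ φ : QubitState, ‖φ.1 1‖ ^ 4 ∂haarQubit +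
      2 * ∫ φ : QubitState, ‖φ.1 0‖ ^ 2 * ‖φ.1 1‖ ^ 2 ∂haarQubit := by
    rw [← integral_const_mul, ← integral_add i0 i1, ← integral_add (i0.fun_add i1) (i2.const_mul 2)]
    have : ∀ φ : QubitState, ‖φ.1 0‖ ^ 4 + ‖φ.1 1‖ ^ 4 + 2 * (‖φ.1 0‖ ^ 2 * ‖φ.1 1‖ ^ 2) = 1 := by
      intro φ
      calc _ = (‖φ.1 0‖ ^ 2 + ‖φ.1 1‖ ^ 2) ^ 2 := by ring
        _ = 1 := by rw [norm_sq_add_norm_sq]; norm_num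
    simp [this]
  have hhad : ∫ φ : QubitState, ‖φ.1 0‖ ^ 4 ∂haarQubit =
      (1 / 4) * (1 + 2 * ∫ φ : QubitState, ‖φ.1 0‖ ^ 2 * ‖φ.1 1‖ ^ 2 ∂haarQubit) := by
    have hs : ‖(((√2)⁻¹ : ℝ) : ℂ)‖ ^ 2 = 1 / 2 := by
      rw [Complex.norm_real, Real.norm_eq_abs, sq_abs, inv_pow, Real.sq_sqrt zero_le_two]; norm_num
    obtain ⟨T, hT⟩ := exists_isometry ((√2)⁻¹ : ℝ) ((√2)⁻¹ : ℝ) ((√2)⁻¹ : ℝ) (-((√2)⁻¹ : ℝ))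
      (by rw [hs]; norm_num) (by rw [norm_neg, hs]; norm_num) (by ring)
    rw [← integral_haarQubit_comp T (fun x => ‖x 0‖ ^ 4)]
    have hq := integral_quadratic_sq 1 1 1
    have hl : ∀ φ : QubitState, ‖T φ 0‖ ^ 4 = (1 / 4 : ℝ) * (1 * ‖φ.1 0‖ ^ 2 + 1 * ‖φ.1 1‖ ^ 2 +
        2 * (star (φ.1 0) * φ.1 1 * 1).re) ^ 2 := by
      intro φ
      have : ‖T φ 0‖ ^ 2 = (1 / 2 : ℝ) * (1 * ‖φ.1 0‖ ^ 2 + 1 * ‖φ.1 1‖ ^ 2 +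
        2 * (star (φ.1 0) * φ.1 1 * 1).re) := by
        rw [(hT _).1, ← mul_add, norm_mul, mul_pow, hs]
        simp only [← Complex.normSq_eq_norm_sq, Complex.normSq_apply]
        simp
        ring
      calc ‖T φ 0‖ ^ 4 = (‖T φ 0‖ ^ 2) ^ 2 := by ring
        _ = _ := by rw [this]; ring
    simp only [hl]
    rw [integral_const_mul, hq]
    simp only [one_mul, norm_sq_add_norm_sq, norm_one, one_pow, mul_one]
    rw [integral_add (integrable_const _) (i2.const_mul 2), integral_const_mul]
    simp
  refine ⟨?_, ?_, ?_⟩ <;> linarith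

/-- With moments `1/3` and `1/6` the integral equals `(a² + b² + ab + ‖g‖²) / 3`, and positivity of
the quadratic form, `‖g‖² ≤ ab`, completes the square. -/
theorem integral_quadratic_sq_le {a b : ℝ} {g : ℂ} (hg : ‖g‖ ^ 2 ≤ a * b) :
    ∫ φ : QubitState, (a * ‖φ.1 0‖ ^ 2 + b * ‖φ.1 1‖ ^ 2 +
        2 * (star (φ.1 0) * φ.1 1 * g).re) ^ 2 ∂haarQubit ≤ (a + b) ^ 2 / 3 := by
  obtain ⟨h0, h1, h2⟩ := integral_norm_pow_four
  have i0 : Integrable (fun φ : QubitState => ‖φ.1 0‖ ^ 4) haarQubit :=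
    integrable_haarQubit (by fun_prop)
  have i1 : Integrable (fun φ : QubitState => ‖φ.1 1‖ ^ 4) haarQubit :=
    integrable_haarQubit (by fun_prop)
  have i2 : Integrable (fun φ : QubitState => ‖φ.1 0‖ ^ 2 * ‖φ.1 1‖ ^ 2) haarQubit :=
    integrable_haarQubit (by fun_prop)
  rw [integral_quadratic_sq]
  have : ∀ φ : QubitState, (a * ‖φ.1 0‖ ^ 2 + b * ‖φ.1 1‖ ^ 2) ^ 2 +
        2 * ‖g‖ ^ 2 * (‖φ.1 0‖ ^ 2 * ‖φ.1 1‖ ^ 2) = a ^ 2 * ‖φ.1 0‖ ^ 4 + b ^ 2 * ‖φ.1 1‖ ^ 4 +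
        (2 * a * b + 2 * ‖g‖ ^ 2) * (‖φ.1 0‖ ^ 2 * ‖φ.1 1‖ ^ 2) := fun φ => by ring
  simp only [this]
  rw [integral_add ((i0.const_mul _).fun_add (i1.const_mul _)) (i2.const_mul _),
    integral_add (i0.const_mul _) (i1.const_mul _), integral_const_mul, integral_const_mul,
    integral_const_mul, h0, h1, h2]
  linarith

/-- The integrand is the square of the quadratic form of the Gram matrix of `w 0` and `w 1`;
Cauchy–Schwarz supplies the bound on its off-diagonal entry. This is the factor `1/3` gained per
qubit. -/
theorem integral_norm_sq_sq_le {ι : Type*} [Fintype ι] (w : Fin 2 → ι → ℂ) :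
    ∫ φ : QubitState, (∑ t, ‖w 0 t * φ.1 0 + w 1 t * φ.1 1‖ ^ 2) ^ 2 ∂haarQubit ≤
      ((∑ t, ‖w 0 t‖ ^ 2) + ∑ t, ‖w 1 t‖ ^ 2) ^ 2 / 3 := by
  set a := ∑ t, ‖w 0 t‖ ^ 2
  set b := ∑ t, ‖w 1 t‖ ^ 2
  set g := ∑ t, star (w 0 t) * w 1 t
  have hg : ‖g‖ ^ 2 ≤ a * b := by
    have h1 : ‖g‖ ≤ ∑ t, ‖w 0 t‖ * ‖w 1 t‖ :=
      (norm_sum_le _ _).trans_eq (Finset.sum_congr rfl fun t _ => by rw [norm_mul, norm_star])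
    exact (pow_le_pow_left₀ (norm_nonneg _) h1 2).trans (Finset.sum_mul_sq_le_sq_mul_sq _ _ _)
  refine le_trans (le_of_eq ?_) (integral_quadratic_sq_le hg)
  refine integral_congr_ae (Eventually.of_forall fun φ => ?_)
  simp only []
  congr 1
  rw [Finset.sum_mul, Finset.sum_mul, Finset.mul_sum, Complex.re_sum, Finset.mul_sum,
    ← Finset.sum_add_distrib, ← Finset.sum_add_distrib]
  refine Finset.sum_congr rfl fun t _ => ?_
  simp only [← Complex.normSq_eq_norm_sq, Complex.normSq_apply]
  simp
  ring

theorem continuous_productState {N : ℕ} (s : Basis N) :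
    Continuous fun φ : Fin N → QubitState => productState φ s := by
  unfold productState
  fun_prop

/-- The fourth moment of the overlap of a fixed vector with a Haar-random product state. -/
theorem lintegral_overlap_pow_four_le (N : ℕ) (w : Basis N → ℂ) :
    ∫⁻ φ, ENNReal.ofReal (‖∑ s, w s * productState φ s‖ ^ 4) ∂haarProduct N ≤
      ENNReal.ofReal ((∑ s, ‖w s‖ ^ 2) ^ 2 / 3 ^ N) := by
  induction N with
  | zero =>
    have : ∀ φ : Fin 0 → QubitState, ‖∑ s, w s * productState φ s‖ ^ 4 =
        (∑ s, ‖w s‖ ^ 2) ^ 2 / 3 ^ 0 := by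
      intro φ
      simp only [productState, Finset.univ_eq_empty, Finset.prod_empty, mul_one, pow_zero, div_one,
        Fintype.sum_unique]
      ring
    simp only [this, lintegral_const, measure_univ, mul_one, le_refl]
  | succ n ih =>
    have hsplit : ∀ F : Basis (n + 1) → ℂ,
        ∑ s, F s = ∑ t : Basis n, ∑ b, F (Fin.cons b t) := by
      intro F
      rw [← (Fin.consEquiv fun _ => Fin 2).sum_comp, Fintype.sum_prod_type, Finset.sum_comm]
      rfl
    have hsplit' : ∀ F : Basis (n + 1) → ℝ,
        ∑ s, F s = ∑ t : Basis n, ∑ b, F (Fin.cons b t) := by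
      intro F
      rw [← (Fin.consEquiv fun _ => Fin 2).sum_comp, Fintype.sum_prod_type, Finset.sum_comm]
      rfl
    have hmp := measurePreserving_piFinSuccAbove (fun _ : Fin (n + 1) => haarQubit) 0
    let G : QubitState × (Fin n → QubitState) → ENNReal := fun q => ENNReal.ofReal
      (‖∑ t, (w (Fin.cons 0 t) * q.1.1 0 + w (Fin.cons 1 t) * q.1.1 1) * productState q.2 t‖ ^ 4)
    have hG : Measurable G := by
      refine (ENNReal.continuous_ofReal.comp ?_).measurable
      refine Continuous.pow (Continuous.norm ?_) 4
      refine continuous_finsetSum _ fun t _ => ?_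
      have := (continuous_productState t).comp
        (continuous_snd (X := QubitState) (Y := Fin n → QubitState))
      refine Continuous.mul ?_ this
      fun_prop
    have h1 : ∫⁻ φ, ENNReal.ofReal (‖∑ s, w s * productState φ s‖ ^ 4) ∂haarProduct (n + 1) =
        ∫⁻ q, G q ∂(haarQubit.prod (haarProduct n)) := by
      rw [haarProduct, haarProduct, ← hmp.lintegral_comp hG]
      refine lintegral_congr fun φ => ?_
      simp only [G]
      congr 3
      rw [hsplit]
      refine Finset.sum_congr rfl fun t _ => ?_
      rw [Fin.sum_univ_two, add_mul]
      simp only [productState, Fin.prod_univ_succ, Fin.cons_zero, Fin.cons_succ]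
      simp only [MeasurableEquiv.piFinSuccAbove_apply, Fin.insertNthEquiv_symm_apply,
        Fin.removeNth_apply, Fin.succAbove_zero]
      ring
    rw [h1, lintegral_prod _ hG.aemeasurable]
    -- The vector contracted with the first qubit state is a fixed vector for the other qubits, so
    -- the induction hypothesis bounds the inner integral. Its squared norm is quadratic in the
    -- first state, and averaging gives one more factor `1/3`.
    calc ∫⁻ φ, ∫⁻ ψ, G (φ, ψ) ∂haarProduct n ∂haarQubit
        ≤ ∫⁻ φ, ENNReal.ofReal ((∑ t, ‖w (Fin.cons 0 t) * φ.1 0 + w (Fin.cons 1 t) * φ.1 1‖ ^ 2) ^ 2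
            / 3 ^ n) ∂haarQubit := lintegral_mono fun φ =>
          ih fun t => w (Fin.cons 0 t) * φ.1 0 + w (Fin.cons 1 t) * φ.1 1
      _ = ENNReal.ofReal (∫ φ, (∑ t, ‖w (Fin.cons 0 t) * φ.1 0 + w (Fin.cons 1 t) * φ.1 1‖ ^ 2) ^ 2
            / 3 ^ n ∂haarQubit) := by
        have hc : Continuous fun φ : QubitState =>
            (∑ t, ‖w (Fin.cons 0 t) * φ.1 0 + w (Fin.cons 1 t) * φ.1 1‖ ^ 2) ^ 2 / 3 ^ n := by
          refine Continuous.div_const (Continuous.pow (continuous_finsetSum _ fun t _ => ?_) 2) _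
          generalize w (Fin.cons 0 t) = u
          generalize w (Fin.cons 1 t) = v
          fun_prop
        exact (ofReal_integral_eq_lintegral_ofReal (integrable_haarQubit hc)
          (Eventually.of_forall fun φ => by positivity)).symm
      _ ≤ _ := by
        refine ENNReal.ofReal_le_ofReal ?_
        rw [integral_div]
        have := integral_norm_sq_sq_le (fun b t => w (Fin.cons b t))
        rw [hsplit']
        simp only [Fin.sum_univ_two, Finset.sum_add_distrib]
        rw [pow_succ (3 : ℝ), mul_comm (3 ^ n) (3 : ℝ), ← div_div]
        gcongr

/-- With high probability, a Haar-random product state has a small inverse participation ratio in a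
given orthonormal basis. -/
theorem haarProduct_participation_gt_le {N : ℕ} {W : Op N}
    (hW : W ∈ Matrix.unitaryGroup (Basis N) ℂ)
    {δ : ℝ} (hδ : 0 < δ) :
    haarProduct N {φ | δ < ∑ j, ‖∑ s, star (W s j) * productState φ s‖ ^ 4} ≤
      ENNReal.ofReal ((2 / 3) ^ N / δ) := by
  have hc : ∀ j, Continuous fun φ : Fin N → QubitState =>
      ‖∑ s, star (W s j) * productState φ s‖ ^ 4 := fun j =>
    ((continuous_finsetSum _ fun s _ =>
      continuous_const.mul (continuous_productState s)).norm).pow 4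
  have hcol : ∀ j, ∑ s, ‖star (W s j)‖ ^ 2 = 1 := by
    intro j
    have h := congrFun (congrFun ((Matrix.mem_unitaryGroup_iff').1 hW) j) j
    rw [Matrix.mul_apply, Matrix.one_apply_eq] at h
    rw [← Complex.ofReal_inj]
    push_cast
    rw [← h]
    refine Finset.sum_congr rfl fun s _ => ?_
    rw [norm_star, Matrix.star_apply, ← Complex.conj_mul']
    rfl
  -- There are `2ᴺ` columns, each a unit vector contributing at most `3⁻ᴺ`; Markov's inequality then
  -- finishes.
  have hmean : ∫⁻ φ, ENNReal.ofReal (∑ j, ‖∑ s, star (W s j) * productState φ s‖ ^ 4)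
      ∂haarProduct N ≤ ENNReal.ofReal ((2 / 3) ^ N) := by
    have h1 : ∀ φ : Fin N → QubitState,
        ENNReal.ofReal (∑ j, ‖∑ s, star (W s j) * productState φ s‖ ^ 4) =
        ∑ j, ENNReal.ofReal (‖∑ s, star (W s j) * productState φ s‖ ^ 4) := fun φ =>
      ENNReal.ofReal_sum_of_nonneg fun j _ => by positivity
    simp only [h1]
    have hm : ∀ j, Measurable fun φ : Fin N → QubitState =>
        ENNReal.ofReal (‖∑ s, star (W s j) * productState φ s‖ ^ 4) := fun j =>
      (ENNReal.continuous_ofReal.comp (hc j)).measurable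
    rw [lintegral_finsetSum _ fun j _ => hm j]
    calc _ ≤ ∑ _j : Basis N, ENNReal.ofReal (1 / 3 ^ N) := by
          refine Finset.sum_le_sum fun j _ => ?_
          have := lintegral_overlap_pow_four_le N fun s => star (W s j)
          rwa [hcol, one_pow] at this
      _ = ENNReal.ofReal ((2 / 3) ^ N) := by
          rw [Finset.sum_const, ← ENNReal.ofReal_nsmul]
          congr 1
          simp [div_eq_mul_inv, mul_pow]
  have hmeas : Measurable fun φ : Fin N → QubitState =>
      ENNReal.ofReal (∑ j, ‖∑ s, star (W s j) * productState φ s‖ ^ 4) :=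
    (ENNReal.continuous_ofReal.comp (continuous_finsetSum _ fun j _ => hc j)).measurable
  calc _ ≤ haarProduct N {φ | ENNReal.ofReal δ ≤
        ENNReal.ofReal (∑ j, ‖∑ s, star (W s j) * productState φ s‖ ^ 4)} :=
        measure_mono fun φ hφ => ENNReal.ofReal_le_ofReal (le_of_lt hφ)
    _ ≤ (∫⁻ φ, ENNReal.ofReal (∑ j, ‖∑ s, star (W s j) * productState φ s‖ ^ 4)
        ∂haarProduct N) / ENNReal.ofReal δ :=
        meas_ge_le_lintegral_div hmeas.aemeasurable (by simpa using hδ) ENNReal.ofReal_ne_top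
    _ ≤ _ := by
        rw [ENNReal.ofReal_div_of_pos hδ]
        gcongr

end KickedIsing

/-! ### Time averages and densities of good periods -/

/-- The Cesàro means of `z ^ m` tend to zero for `z ≠ 1` on the unit circle. -/
theorem Complex.tendsto_cesaro_pow {z : ℂ} (hz : ‖z‖ = 1) (h1 : z ≠ 1) :
    Tendsto (fun M : ℕ => (M : ℂ)⁻¹ * ∑ m ∈ Finset.range M, z ^ m) atTop (𝓝 0) := by
  refine squeeze_zero_norm (a := fun M : ℕ => (M : ℝ)⁻¹ * (2 / ‖z - 1‖)) (fun M => ?_) ?_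
  · rw [norm_mul, norm_inv, Complex.norm_natCast, geom_sum_eq h1, norm_div]
    gcongr
    calc ‖z ^ M - 1‖ ≤ ‖z ^ M‖ + ‖(1 : ℂ)‖ := norm_sub_le _ _
      _ = 2 := by rw [norm_pow, hz]; norm_num
  · simpa using (tendsto_inv_atTop_nhds_zero_nat (𝕜 := ℝ)).mul_const (2 / ‖z - 1‖)

/-- Parseval identity in mean for trigonometric sums with distinct frequencies and coefficients
depending continuously on a parameter. -/
theorem tendsto_cesaro_integral_norm_sq {S : Type*} [Fintype S] {ω : S → ℂ}
    (hω : Function.Injective ω) (hn : ∀ α, ‖ω α‖ = 1) {b : S → ℝ → ℂ} (hb : ∀ α, Continuous (b α)) :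
    Tendsto (fun M : ℕ => (M : ℝ)⁻¹ * ∑ m ∈ Finset.range M,
      ∫ x in Set.Ico (0 : ℝ) 1, ‖∑ α, b α x * ω α ^ m‖ ^ 2) atTop
      (𝓝 (∑ α, ∫ x in Set.Ico (0 : ℝ) 1, ‖b α x‖ ^ 2)) := by
  classical
  have hint : ∀ f : ℝ → ℂ, Continuous f → IntegrableOn f (Set.Ico (0 : ℝ) 1) := fun f hf =>
    (hf.integrableOn_Icc (a := 0) (b := 1)).mono_set Set.Ico_subset_Icc_self
  set C : S → S → ℂ := fun α β => ∫ x in Set.Ico (0 : ℝ) 1, b α x * star (b β x) with hC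
  have hexp : ∀ m : ℕ, ((∫ x in Set.Ico (0 : ℝ) 1, ‖∑ α, b α x * ω α ^ m‖ ^ 2 : ℝ) : ℂ) =
      ∑ α, ∑ β, C α β * (ω α * star (ω β)) ^ m := by
    intro m
    rw [← integral_complex_ofReal]
    have hpt : ∀ x, ((‖∑ α, b α x * ω α ^ m‖ ^ 2 : ℝ) : ℂ) =
        ∑ α, ∑ β, b α x * star (b β x) * (ω α * star (ω β)) ^ m := by
      intro x
      push_cast
      rw [← Complex.mul_conj', map_sum, Finset.sum_mul_sum]
      refine Finset.sum_congr rfl fun α _ => Finset.sum_congr rfl fun β _ => ?_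
      simp only [map_mul, map_pow, RCLike.star_def, mul_pow]
      ring
    simp only [hpt]
    have hcont : ∀ α β, Continuous fun x => b α x * star (b β x) * (ω α * star (ω β)) ^ m :=
      fun α β => ((hb α).mul (hb β).star).mul continuous_const
    rw [integral_finsetSum _ fun α _ => hint _ (continuous_finsetSum _ fun β _ =>
      hcont α β)]
    refine Finset.sum_congr rfl fun α _ => ?_
    rw [integral_finsetSum _ fun β _ => hint _ (hcont α β)]
    refine Finset.sum_congr rfl fun β _ => ?_
    rw [integral_mul_const]
  -- For `α ≠ β` the number `ω α * star (ω β)` lies on the unit circle and differs from `1`, so only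
  -- diagonal terms survive the averaging.
  have hlim : Tendsto (fun M : ℕ => ∑ α, ∑ β, C α β *
      ((M : ℂ)⁻¹ * ∑ m ∈ Finset.range M, (ω α * star (ω β)) ^ m)) atTop
      (𝓝 (∑ α, ∑ β, C α β * if α = β then 1 else 0)) := by
    refine tendsto_finsetSum _ fun α _ => tendsto_finsetSum _ fun β _ => ?_
    refine Tendsto.const_mul _ ?_
    have hunit : ω β * star (ω β) = 1 := by
      rw [RCLike.star_def, Complex.mul_conj', hn]; norm_num
    split_ifs with h
    · subst h
      simp only [hunit, one_pow, Finset.sum_const, Finset.card_range, nsmul_eq_mul, mul_one]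
      refine tendsto_const_nhds.congr' ?_
      filter_upwards [eventually_gt_atTop 0] with M hM
      rw [inv_mul_cancel₀]
      exact_mod_cast hM.ne'
    · refine Complex.tendsto_cesaro_pow (by rw [norm_mul, norm_star, hn, hn, one_mul]) ?_
      intro h1
      apply h
      apply hω
      calc ω α = ω α * (ω β * star (ω β)) := by rw [hunit, mul_one]
        _ = (ω α * star (ω β)) * ω β := by ring
        _ = ω β := by rw [h1, one_mul]
  have hre := (Complex.continuous_re.tendsto _).comp hlim
  refine Tendsto.congr (fun M => ?_) (hre.trans (le_of_eq ?_))
  · have : (((M : ℝ)⁻¹ * ∑ m ∈ Finset.range M,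
        ∫ x in Set.Ico (0 : ℝ) 1, ‖∑ α, b α x * ω α ^ m‖ ^ 2 : ℝ) : ℂ) =
        ∑ α, ∑ β, C α β * ((M : ℂ)⁻¹ * ∑ m ∈ Finset.range M, (ω α * star (ω β)) ^ m) := by
      push_cast [-Complex.ofReal_pow]
      simp only [hexp]
      rw [Finset.sum_comm, Finset.mul_sum]
      refine Finset.sum_congr rfl fun α _ => ?_
      rw [Finset.sum_comm, Finset.mul_sum]
      refine Finset.sum_congr rfl fun β _ => ?_
      rw [← Finset.mul_sum]; ring
    rw [Function.comp_apply, ← this, Complex.ofReal_re]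
  · congr 1
    have : (∑ α, ∑ β, C α β * if α = β then (1 : ℂ) else 0) =
        ((∑ α, ∫ x in Set.Ico (0 : ℝ) 1, ‖b α x‖ ^ 2 : ℝ) : ℂ) := by
      push_cast
      refine Finset.sum_congr rfl fun α _ => ?_
      simp only [mul_ite, mul_one, mul_zero, Finset.sum_ite_eq, Finset.mem_univ, if_true, hC]
      rw [← integral_complex_ofReal]
      refine integral_congr_ae (Eventually.of_forall fun x => ?_)
      simp only [RCLike.star_def, Complex.mul_conj']
      push_cast
      rfl
    rw [this, Complex.ofReal_re]

/-- If the Cesàro means of a nonnegative sequence tend to at most `ε²`, then the lower density of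
the indices where it is at most `ε` is at least `1 - ε`. -/
theorem one_sub_le_liminf_density {a : ℕ → ℝ} (ha : ∀ m, 0 ≤ a m) {ε L : ℝ} (hε : 0 < ε)
    (hL : L ≤ ε ^ 2)
    (hlim : Tendsto (fun M : ℕ => (M : ℝ)⁻¹ * ∑ m ∈ Finset.range M, a m) atTop (𝓝 L))
    {P : ℕ → Prop} [DecidablePred P] (hP : ∀ m, a m ≤ ε → P m) :
    1 - ε ≤ liminf (fun M : ℕ => (((Finset.range M).filter P).card : ℝ) / (M : ℝ)) atTop := by
  -- Markov's inequality for the uniform distribution on the first `M` indices.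
  have hcount : ∀ M : ℕ, 0 < M → 1 - ((M : ℝ)⁻¹ * ∑ m ∈ Finset.range M, a m) / ε ≤
      (((Finset.range M).filter P).card : ℝ) / (M : ℝ) := by
    intro M hM
    have hM' : (0 : ℝ) < M := by exact_mod_cast hM
    have h1 : ((Finset.range M).filter P).card + ((Finset.range M).filter fun m => ¬ P m).card =
        M := by
      rw [Finset.card_filter_add_card_filter_not, Finset.card_range]
    have h2 : (((Finset.range M).filter fun m => ¬ P m).card : ℝ) * ε ≤
        ∑ m ∈ Finset.range M, a m := by
      calc _ = ∑ m ∈ (Finset.range M).filter fun m => ¬ P m, ε := by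
            rw [Finset.sum_const, nsmul_eq_mul]
        _ ≤ ∑ m ∈ (Finset.range M).filter fun m => ¬ P m, a m := by
            refine Finset.sum_le_sum fun m hm => ?_
            by_contra h
            exact (Finset.mem_filter.1 hm).2 (hP m (le_of_not_ge h))
        _ ≤ _ := Finset.sum_le_sum_of_subset_of_nonneg (Finset.filter_subset _ _)
            fun m _ _ => ha m
    have h3 : (((Finset.range M).filter P).card : ℝ) =
        M - ((Finset.range M).filter fun m => ¬ P m).card := by
      rw [eq_sub_iff_add_eq]; exact_mod_cast h1
    rw [h3, sub_div, div_self hM'.ne']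
    have h4 : (((Finset.range M).filter fun m => ¬ P m).card : ℝ) / M ≤
        ((M : ℝ)⁻¹ * ∑ m ∈ Finset.range M, a m) / ε := by
      rw [div_le_div_iff₀ hM' hε, mul_comm (M : ℝ)⁻¹, mul_assoc, inv_mul_cancel₀ hM'.ne', mul_one]
      exact h2
    linarith
  have hlim' : Tendsto (fun M : ℕ => 1 - ((M : ℝ)⁻¹ * ∑ m ∈ Finset.range M, a m) / ε) atTop
      (𝓝 (1 - L / ε)) := tendsto_const_nhds.sub (hlim.div_const ε)
  have h1 : 1 - ε ≤ 1 - L / ε := by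
    have : L / ε ≤ ε := by rw [div_le_iff₀ hε]; nlinarith
    linarith
  refine h1.trans ?_
  rw [← hlim'.liminf_eq]
  refine liminf_le_liminf ?_ hlim'.isBoundedUnder_ge ?_
  · filter_upwards [eventually_gt_atTop 0] with M hM using hcount M hM
  · refine IsBoundedUnder.isCoboundedUnder_ge (isBoundedUnder_of ⟨1, fun M => ?_⟩)
    refine div_le_one_of_le₀ ?_ (Nat.cast_nonneg _)
    exact_mod_cast (Finset.card_filter_le _ _).trans_eq (Finset.card_range M)

/-! ### From participation ratio to approximate periodicity -/

theorem Matrix.sum_norm_sq_column_le {ι : Type*} [Fintype ι] [DecidableEq ι] (B : Matrix ι ι ℂ)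
    (k : ι) : ∑ j, ‖B j k‖ ^ 2 ≤ ‖B‖ ^ 2 := by
  have h := Matrix.l2_opNorm_mulVec B (EuclideanSpace.single k (1 : ℂ))
  rw [PiLp.norm_single, norm_one, mul_one] at h
  have h2 := pow_le_pow_left₀ (norm_nonneg _) h 2
  rw [EuclideanSpace.norm_sq_eq] at h2
  simpa [EuclideanSpace.single] using h2

theorem Matrix.sum_norm_sq_row_le {ι : Type*} [Fintype ι] [DecidableEq ι] (B : Matrix ι ι ℂ)
    (j : ι) : ∑ k, ‖B j k‖ ^ 2 ≤ ‖B‖ ^ 2 := by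
  have h := Matrix.sum_norm_sq_column_le Bᴴ j
  rw [Matrix.l2_opNorm_conjTranspose] at h
  simpa using h

/-- By AM–GM, `‖c j‖² ‖c k‖²` is at most the mean of `‖c j‖⁴` and `‖c k‖⁴`; the remaining sums run
over one row or one column of `B`, whose squared norm is at most `1`. -/
theorem Matrix.sum_offDiag_weights_le {ι : Type*} [Fintype ι] [DecidableEq ι] {B : Matrix ι ι ℂ}
    (hB : ‖B‖ ≤ 1) (c : ι → ℂ) :
    ∑ j, ∑ k, ‖c j‖ ^ 2 * ‖c k‖ ^ 2 * ‖B j k‖ ^ 2 ≤ ∑ j, ‖c j‖ ^ 4 := by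
  have hB2 : ‖B‖ ^ 2 ≤ 1 := pow_le_one₀ (norm_nonneg _) hB
  have h1 : ∀ j k, ‖c j‖ ^ 2 * ‖c k‖ ^ 2 * ‖B j k‖ ^ 2 ≤
      (1 / 2) * (‖c j‖ ^ 4 * ‖B j k‖ ^ 2) + (1 / 2) * (‖c k‖ ^ 4 * ‖B j k‖ ^ 2) := by
    intro j k
    nlinarith [mul_nonneg (sq_nonneg (‖c j‖ ^ 2 - ‖c k‖ ^ 2)) (sq_nonneg ‖B j k‖)]
  have h2 : ∑ j, ∑ k, ‖c j‖ ^ 4 * ‖B j k‖ ^ 2 ≤ ∑ j, ‖c j‖ ^ 4 := by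
    refine Finset.sum_le_sum fun j _ => ?_
    rw [← Finset.mul_sum]
    exact mul_le_of_le_one_right (by positivity) ((B.sum_norm_sq_row_le j).trans hB2)
  have h3 : ∑ j, ∑ k, ‖c k‖ ^ 4 * ‖B j k‖ ^ 2 ≤ ∑ j, ‖c j‖ ^ 4 := by
    rw [Finset.sum_comm]
    refine Finset.sum_le_sum fun j _ => ?_
    rw [← Finset.mul_sum]
    exact mul_le_of_le_one_right (by positivity) ((B.sum_norm_sq_column_le j).trans hB2)
  calc _ ≤ ∑ j, ∑ k, ((1 / 2) * (‖c j‖ ^ 4 * ‖B j k‖ ^ 2) + (1 / 2) * (‖c k‖ ^ 4 * ‖B j k‖ ^ 2)) :=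
        Finset.sum_le_sum fun j _ => Finset.sum_le_sum fun k _ => h1 j k
    _ = (1 / 2) * ∑ j, ∑ k, ‖c j‖ ^ 4 * ‖B j k‖ ^ 2 +
        (1 / 2) * ∑ j, ∑ k, ‖c k‖ ^ 4 * ‖B j k‖ ^ 2 := by
      simp only [Finset.sum_add_distrib, Finset.mul_sum]
    _ ≤ _ := by linarith

theorem Matrix.norm_eigenvalue_of_mem_unitaryGroup {ι : Type*} [Fintype ι] [DecidableEq ι]
    {U W : Matrix ι ι ℂ} {μ : ι → ℂ} (hU : U ∈ Matrix.unitaryGroup ι ℂ)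
    (hW : W ∈ Matrix.unitaryGroup ι ℂ) (h : U * W = W * Matrix.diagonal μ) (j : ι) : ‖μ j‖ = 1 := by
  have hd : Matrix.diagonal μ ∈ Matrix.unitaryGroup ι ℂ := by
    have : Matrix.diagonal μ = star W * (U * W) := by
      rw [h, ← mul_assoc, (Matrix.mem_unitaryGroup_iff').1 hW, one_mul]
    rw [this]
    exact mul_mem (Unitary.star_mem hW) (mul_mem hU hW)
  have h1 := congrFun (congrFun ((Matrix.mem_unitaryGroup_iff').1 hd) j) j
  rw [Matrix.star_eq_conjTranspose, Matrix.diagonal_conjTranspose, Matrix.diagonal_mul_diagonal,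
    Matrix.diagonal_apply_eq, Matrix.one_apply_eq, Pi.star_apply, RCLike.star_def,
    Complex.conj_mul'] at h1
  have h2 : ‖μ j‖ ^ 2 = 1 := by exact_mod_cast h1
  exact (pow_eq_one_iff_of_nonneg (norm_nonneg _) two_ne_zero).1 h2

namespace KickedIsing

/-- If the products of pairs of eigenvalues of the Floquet operator are distinct and the inverse
participation ratio of the initial state is at most `ε²`, then expectation values are
`ε`-periodic. -/
theorem isApproxPeriodic_expectation {N : ℕ} {p : Params N} {W : Op N} {μ : Basis N → ℂ}
    (hW : W ∈ Matrix.unitaryGroup (Basis N) ℂ) (hUW : floquetOp p * W = W * Matrix.diagonal μ)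
    (hμ : HasDistinctProducts μ) {A : Op N} (hA : ‖A‖ ≤ 1) {ψ : Basis N → ℂ} {ε : ℝ} (hε : 0 < ε)
    (hψ : ∑ j, ‖∑ s, star (W s j) * ψ s‖ ^ 4 ≤ ε ^ 2) :
    IsApproxPeriodic ε (expectation p A ψ) := by
  classical
  set c : Basis N → ℂ := fun j => ∑ s, star (W s j) * ψ s with hc
  -- The observable in the Heisenberg picture at the fraction `x` of a period, written in the
  -- Floquet eigenbasis.
  set B : ℝ → Op N := fun x => (partialPeriod p x * W)ᴴ * A * (partialPeriod p x * W) with hBdef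
  have hn := Matrix.norm_eigenvalue_of_mem_unitaryGroup (floquetOp_mem_unitary p) hW hUW
  have hcW : W *ᵥ c = ψ := by
    have : c = star W *ᵥ ψ := by
      ext j; simp [hc, Matrix.mulVec, dotProduct, Matrix.star_apply]
    rw [this, Matrix.mulVec_mulVec, (Matrix.mem_unitaryGroup_iff).1 hW, Matrix.one_mulVec]
  have hUm : ∀ m : ℕ, floquetOp p ^ m *ᵥ ψ = W *ᵥ fun j => μ j ^ m * c j := by
    intro m
    have := (SemiconjBy.pow_right (a := W) (x := Matrix.diagonal μ) (y := floquetOp p)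
      hUW.symm m).eq
    rw [← hcW, Matrix.mulVec_mulVec, ← this, Matrix.diagonal_pow, ← Matrix.mulVec_mulVec]
    congr 1
    ext j
    rw [Matrix.mulVec_diagonal]; rfl
  have hBcont : Continuous B := by
    have hV : Continuous fun x => partialPeriod p x * W :=
      (continuous_partialPeriod p).mul continuous_const
    exact (hV.matrix_conjTranspose.matrix_mul continuous_const).matrix_mul hV
  have hBent : ∀ j k, Continuous fun x => B x j k := fun j k => hBcont.matrix_elem j k
  have hBnorm : ∀ x, ‖B x‖ ≤ 1 := by
    intro x
    have hV : partialPeriod p x * W ∈ Matrix.unitaryGroup (Basis N) ℂ :=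
      mul_mem (partialPeriod_mem_unitary p x) hW
    have h1 : ‖partialPeriod p x * W‖ = 1 := CStarRing.norm_of_mem_unitary hV
    calc ‖B x‖ ≤ ‖(partialPeriod p x * W)ᴴ‖ * ‖A‖ * ‖partialPeriod p x * W‖ :=
          (norm_mul_le _ _).trans (mul_le_mul_of_nonneg_right (norm_mul_le _ _) (norm_nonneg _))
      _ ≤ 1 := by rw [Matrix.l2_opNorm_conjTranspose, h1]; simpa using hA
  have hexp : ∀ (m : ℕ) (x : ℝ), x ∈ Set.Ico (0 : ℝ) 1 → expectation p A ψ (m + x) =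
      (∑ j, ∑ k, star (μ j ^ m * c j) * B x j k * (μ k ^ m * c k)).re := by
    intro m x hx
    have hfr : Int.fract ((m : ℝ) + x) = x := by
      rw [Int.fract_natCast_add, Int.fract_eq_self.2 hx]
    have hfl : ⌊(m : ℝ) + x⌋₊ = m := by
      rw [Nat.floor_eq_iff (add_nonneg m.cast_nonneg hx.1)]
      exact ⟨by linarith [hx.1], by linarith [hx.2]⟩
    rw [expectation, propagator, hfr, hfl, ← Matrix.mulVec_mulVec, hUm, Matrix.mulVec_mulVec,
      Matrix.star_mulVec, Matrix.mulVec_mulVec, ← Matrix.dotProduct_mulVec, Matrix.mulVec_mulVec]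
    congr 1
    rw [← mul_assoc]
    change _ ⬝ᵥ (B x *ᵥ _) = _
    simp only [dotProduct, Matrix.mulVec, Finset.mul_sum, Pi.star_apply, mul_assoc]
  -- The diagonal part, which is the same in every period since `star (μ j) * μ j = 1`.
  set g : ℝ → ℝ := fun x => (∑ j, star (c j) * B x j j * c j).re with hg
  have hgc : Continuous g := Complex.continuous_re.comp <|
    continuous_finsetSum _ fun j _ => (continuous_const.mul (hBent j j)).mul continuous_const
  let S := {q : Basis N × Basis N // q.1 ≠ q.2}
  let ω : S → ℂ := fun q => star (μ q.1.1) * μ q.1.2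
  let b : S → ℝ → ℂ := fun q x => star (c q.1.1) * B x q.1.1 q.1.2 * c q.1.2
  have hunit : ∀ j, star (μ j) * μ j = 1 := fun j => by
    rw [RCLike.star_def, Complex.conj_mul', hn]; norm_num
  have hωn : ∀ q, ‖ω q‖ = 1 := fun q => by rw [norm_mul, norm_star, hn, hn, one_mul]
  -- Clearing conjugates turns equality of two ratios into an equality of products. Of its two
  -- trivial solutions one identifies the index pairs, the other would force `j = k`.
  have hωi : Function.Injective ω := by
    rintro ⟨⟨j, k⟩, hjk⟩ ⟨⟨l, m⟩, hlm⟩ h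
    have h1 : μ k * μ l = μ m * μ j := by
      have h' : star (μ j) * μ k = star (μ l) * μ m := h
      calc μ k * μ l = (star (μ j) * μ j) * (μ k * μ l) := by rw [hunit, one_mul]
        _ = (star (μ j) * μ k) * (μ j * μ l) := by ring
        _ = (star (μ l) * μ l) * (μ m * μ j) := by rw [h']; ring
        _ = _ := by rw [hunit, one_mul]
    rcases hμ _ _ _ _ h1 with ⟨h2, h3⟩ | ⟨h2, h3⟩
    · simp [h2, h3]
    · exact absurd h2.symm hjk
  have hbc : ∀ q, Continuous (b q) := fun q =>
    (continuous_const.mul (hBent _ _)).mul continuous_const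
  have hdiff : ∀ (m : ℕ) (x : ℝ), x ∈ Set.Ico (0 : ℝ) 1 →
      expectation p A ψ (m + x) - g x = (∑ q, b q x * ω q ^ m).re := by
    intro m x hx
    rw [hexp m x hx, hg, ← Complex.sub_re]
    congr 1
    rw [sub_eq_iff_eq_add]
    have h1 : ∑ j, ∑ k, star (μ j ^ m * c j) * B x j k * (μ k ^ m * c k) =
        ∑ q : Basis N × Basis N, (star (c q.1) * B x q.1 q.2 * c q.2) *
          (star (μ q.1) * μ q.2) ^ m := by
      rw [Fintype.sum_prod_type]
      refine Finset.sum_congr rfl fun j _ => Finset.sum_congr rfl fun k _ => ?_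
      simp only [star_mul', star_pow, mul_pow]
      ring
    rw [h1, ← Fintype.sum_subtype_add_sum_subtype (fun q : Basis N × Basis N => q.1 ≠ q.2)]
    congr 1
    let e : Basis N ≃ {q : Basis N × Basis N // ¬ q.1 ≠ q.2} :=
      { toFun := fun j => ⟨(j, j), by simp⟩
        invFun := fun q => q.1.1
        left_inv := fun j => rfl
        right_inv := fun q => by
          obtain ⟨⟨j, k⟩, h⟩ := q
          have h' : j = k := not_not.1 h
          subst h'; rfl }
    rw [← e.sum_comp]
    refine Finset.sum_congr rfl fun j _ => ?_
    change star (c j) * B x j j * c j * (star (μ j) * μ j) ^ m = _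
    rw [hunit, one_pow, mul_one]
  have hsumc : ∀ m : ℕ, Continuous fun x => ∑ q, b q x * ω q ^ m := fun m =>
    continuous_finsetSum _ fun q _ => (hbc q).mul continuous_const
  have hintr : ∀ f : ℝ → ℝ, Continuous f → IntegrableOn f (Set.Ico (0 : ℝ) 1) := fun f hf =>
    (hf.integrableOn_Icc (a := 0) (b := 1)).mono_set Set.Ico_subset_Icc_self
  refine ⟨g, hgc.measurable, ?_⟩
  refine one_sub_le_liminf_density
    (a := fun m => ∫ x in Set.Ico (0 : ℝ) 1, ‖∑ q, b q x * ω q ^ m‖ ^ 2)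
    (fun m => integral_nonneg fun x => by positivity) hε ?_
    (tendsto_cesaro_integral_norm_sq hωi hωn hbc) ?_
  · have h1 : ∑ q, ∫ x in Set.Ico (0 : ℝ) 1, ‖b q x‖ ^ 2 =
        ∫ x in Set.Ico (0 : ℝ) 1, ∑ q, ‖b q x‖ ^ 2 :=
      (integral_finsetSum _ fun q _ => hintr _ ((hbc q).norm.pow 2)).symm
    rw [h1]
    refine le_trans ?_ hψ
    have h2 : ∀ x, ∑ q, ‖b q x‖ ^ 2 ≤ ∑ j, ‖c j‖ ^ 4 := by
      intro x
      refine le_trans ?_ (Matrix.sum_offDiag_weights_le (hBnorm x) c)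
      rw [← Fintype.sum_prod_type' (f := fun j k => ‖c j‖ ^ 2 * ‖c k‖ ^ 2 * ‖B x j k‖ ^ 2),
        ← Fintype.sum_subtype_add_sum_subtype (fun q : Basis N × Basis N => q.1 ≠ q.2)]
      refine le_add_of_le_of_nonneg (le_of_eq ?_) (Finset.sum_nonneg fun q _ => by positivity)
      refine Finset.sum_congr rfl fun q _ => ?_
      simp only [b, norm_mul, norm_star]
      ring
    calc ∫ x in Set.Ico (0 : ℝ) 1, ∑ q, ‖b q x‖ ^ 2 ≤
          ∫ _x in Set.Ico (0 : ℝ) 1, ∑ j, ‖c j‖ ^ 4 :=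
          integral_mono (hintr _ (continuous_finsetSum _ fun q _ => (hbc q).norm.pow 2))
            (hintr _ continuous_const) h2
      _ = ∑ j, ‖c j‖ ^ 4 := by simp
  · intro m hm
    have hcongr : Set.EqOn (fun x : ℝ => |expectation p A ψ (m + x) - g x| ^ 2)
        (fun x => |(∑ q, b q x * ω q ^ m).re| ^ 2) (Set.Ico 0 1) := fun x hx => by
      simp only [hdiff m x hx]
    have hrec : Continuous fun x => |(∑ q, b q x * ω q ^ m).re| ^ 2 :=
      (Complex.continuous_re.comp (hsumc m)).abs.pow 2
    refine ⟨(hintr _ hrec).congr_fun hcongr.symm measurableSet_Ico, ?_⟩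
    rw [setIntegral_congr_fun measurableSet_Ico hcongr]
    refine le_trans (integral_mono (hintr _ hrec) (hintr _ ((hsumc m).norm.pow 2)) fun x => ?_) hm
    exact pow_le_pow_left₀ (abs_nonneg _) (Complex.abs_re_le_norm _) 2

end KickedIsing

/-! ### Perturbation theory of eigenvalues and eigenvectors -/

/-- Eigenvalues and eigenvectors of `U · diag(exp(t κ))` near a nondegenerate eigenvalue of `U`
can be chosen differentiable at `t = 0`. -/
theorem exists_eigenpair_branch {ι : Type*} [Fintype ι] [DecidableEq ι] (U : Matrix ι ι ℂ)
    (κ : ι → ℂ) {v₀ : ι → ℂ} {μ₀ : ℂ} (heig : U *ᵥ v₀ = μ₀ • v₀) (hv₀ : star v₀ ⬝ᵥ v₀ = 1)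
    (hinj : ∀ (w : ι → ℂ) (ν : ℂ), U *ᵥ w - μ₀ • w = ν • v₀ → star v₀ ⬝ᵥ w = 0 → w = 0 ∧ ν = 0) :
    ∃ (v : ℝ → ι → ℂ) (μ : ℝ → ℂ) (v' : ι → ℂ) (μ' : ℂ), v 0 = v₀ ∧ μ 0 = μ₀ ∧
      HasDerivAt v v' 0 ∧ HasDerivAt μ μ' 0 ∧ star v₀ ⬝ᵥ v' = 0 ∧
      U *ᵥ (fun s => κ s * v₀ s) + U *ᵥ v' = μ' • v₀ + μ₀ • v' ∧
      ∀ᶠ t : ℝ in 𝓝 0, U *ᵥ (fun s => Complex.exp (t * κ s) * v t s) = μ t • v t := by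
  -- Keeping `t` as a coordinate lets the inverse function theorem act as an implicit function
  -- theorem: the branch is the local inverse along `(t, 0, 1)`. The last component normalizes by
  -- `star v₀ ⬝ᵥ v = 1`, which is analytic and removes the freedom of scaling.
  let F : ℝ × (ι → ℂ) × ℂ → ℝ × (ι → ℂ) × ℂ := fun x =>
    (x.1, U *ᵥ (fun s => Complex.exp (x.1 * κ s) * x.2.1 s) - x.2.2 • x.2.1, star v₀ ⬝ᵥ x.2.1)
  have hFc : ContDiff ℝ 1 F := by
    have hof : ContDiff ℝ 1 fun x : ℝ × (ι → ℂ) × ℂ => (x.1 : ℂ) :=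
      Complex.ofRealCLM.contDiff.comp contDiff_fst
    refine contDiff_fst.prodMk (ContDiff.prodMk ?_ ?_)
    · refine ContDiff.sub ?_ ?_
      · refine contDiff_pi.2 fun r => ?_
        simp only [Matrix.mulVec, dotProduct]
        fun_prop
      · fun_prop
    · simp only [dotProduct]
      fun_prop
  have hF : HasStrictFDerivAt F (fderiv ℝ F (0, v₀, μ₀)) (0, v₀, μ₀) :=
    hFc.contDiffAt.hasStrictFDerivAt one_ne_zero
  have hF0 : F (0, v₀, μ₀) = (0, 0, 1) := by
    simp [F, heig, hv₀]
  -- In finite dimension a trivial kernel makes the derivative invertible. The derivative is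
  -- evaluated along a line in the direction `x`; once the `t`-component vanishes, the exponential
  -- drops out and `hinj` applies.
  have hker : ∀ x, fderiv ℝ F (0, v₀, μ₀) x = 0 → x = 0 := by
    rintro ⟨τ, w, ν⟩ hx
    have hd : HasDerivAt (fun r : ℝ => F ((0, v₀, μ₀) + r • (τ, w, ν))) 0 0 := by
      have h1 : HasDerivAt (fun r : ℝ => (0, v₀, μ₀) + r • (τ, w, ν)) (τ, w, ν) 0 := by
        simpa using ((hasDerivAt_id (0 : ℝ)).smul_const (τ, w, ν)).const_add (0, v₀, μ₀)
      have h2 : HasFDerivAt F (fderiv ℝ F (0, v₀, μ₀)) ((0, v₀, μ₀) + (0 : ℝ) • (τ, w, ν)) := by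
        simpa using hF.hasFDerivAt
      have h3 := h2.comp_hasDerivAt (0 : ℝ) h1
      rwa [hx] at h3
    have hτ : τ = 0 := by
      have h1 : HasDerivAt (fun r : ℝ => 0 + r * τ) 0 0 :=
        (hasFDerivAt_fst (𝕜 := ℝ) (E := ℝ) (F := (ι → ℂ) × ℂ)).comp_hasDerivAt (0 : ℝ) hd
      have h2 : HasDerivAt (fun r : ℝ => 0 + r * τ) τ 0 := by
        simpa using ((hasDerivAt_id (0 : ℝ)).mul_const τ).const_add 0
      exact h2.unique h1
    subst hτ
    have h1 : HasDerivAt (fun r : ℝ => U *ᵥ (v₀ + r • w) - (μ₀ + r • ν) • (v₀ + r • w)) 0 0 := by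
      have := (hasFDerivAt_fst (𝕜 := ℝ) (E := ι → ℂ) (F := ℂ)).comp_hasDerivAt (0 : ℝ)
        ((hasFDerivAt_snd (𝕜 := ℝ) (E := ℝ) (F := (ι → ℂ) × ℂ)).comp_hasDerivAt (0 : ℝ) hd)
      have hfun : (fun r : ℝ => U *ᵥ (v₀ + r • w) - (μ₀ + r • ν) • (v₀ + r • w)) =
          Prod.fst ∘ Prod.snd ∘ fun r : ℝ => F ((0, v₀, μ₀) + r • (0, w, ν)) := by
        funext r
        simp [F]
        rfl
      rw [hfun]
      exact this
    have h2 : HasDerivAt (fun r : ℝ => star v₀ ⬝ᵥ (v₀ + r • w)) 0 0 :=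
      (hasFDerivAt_snd (𝕜 := ℝ) (E := ι → ℂ) (F := ℂ)).comp_hasDerivAt (0 : ℝ)
        ((hasFDerivAt_snd (𝕜 := ℝ) (E := ℝ) (F := (ι → ℂ) × ℂ)).comp_hasDerivAt (0 : ℝ) hd)
    have hl : HasDerivAt (fun r : ℝ => v₀ + r • w) w 0 := by
      simpa using ((hasDerivAt_id (0 : ℝ)).smul_const w).const_add v₀
    have hm : HasDerivAt (fun r : ℝ => μ₀ + r • ν) ν 0 := by
      simpa using ((hasDerivAt_id (0 : ℝ)).smul_const ν).const_add μ₀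
    have hU : HasDerivAt (fun r : ℝ => U *ᵥ (v₀ + r • w)) (U *ᵥ w) 0 :=
      ((Matrix.mulVecLin U).restrictScalars ℝ).toContinuousLinearMap.hasFDerivAt.comp_hasDerivAt
        (0 : ℝ) hl
    have hD : HasDerivAt (fun r : ℝ => star v₀ ⬝ᵥ (v₀ + r • w)) (star v₀ ⬝ᵥ w) 0 := by
      have := HasDerivAt.fun_sum (u := Finset.univ) fun s _ =>
        ((hasDerivAt_pi.1 hl s).const_mul (star v₀ s))
      exact this
    have e1 := (hU.sub (hm.smul hl)).unique h1
    have e2 := hD.unique h2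
    simp only [zero_smul, add_zero] at e1
    have e1' : U *ᵥ w - μ₀ • w = ν • v₀ := by
      rw [sub_eq_zero] at e1
      rw [e1]; abel
    obtain ⟨rfl, rfl⟩ := hinj w ν e1' e2
    rfl
  let e : (ℝ × (ι → ℂ) × ℂ) ≃L[ℝ] (ℝ × (ι → ℂ) × ℂ) :=
    (LinearEquiv.ofInjectiveEndo (fderiv ℝ F (0, v₀, μ₀) : _ →ₗ[ℝ] _)
      ((injective_iff_map_eq_zero _).2 hker)).toContinuousLinearEquiv
  have he : HasStrictFDerivAt F (e : (ℝ × (ι → ℂ) × ℂ) →L[ℝ] (ℝ × (ι → ℂ) × ℂ)) (0, v₀, μ₀) := by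
    convert hF using 1
    ext x <;> rfl
  let γ : ℝ → ℝ × (ι → ℂ) × ℂ := fun t => he.localInverse F e _ (t, 0, 1)
  have hline : HasDerivAt (fun t : ℝ => ((t, 0, 1) : ℝ × (ι → ℂ) × ℂ)) (1, 0, 0) 0 :=
    (hasDerivAt_id (0 : ℝ)).prodMk ((hasDerivAt_const _ _).prodMk (hasDerivAt_const _ _))
  have hγ0 : γ 0 = (0, v₀, μ₀) := by
    have := he.localInverse_apply_image
    rwa [hF0] at this
  have hγ : HasDerivAt γ (e.symm (1, 0, 0)) 0 := by
    have h1 := he.to_localInverse.hasFDerivAt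
    rw [hF0] at h1
    exact h1.comp_hasDerivAt (0 : ℝ) hline
  have hinv : ∀ᶠ t in 𝓝 (0 : ℝ), F (γ t) = (t, 0, 1) := by
    have h1 := he.eventually_right_inverse
    rw [hF0] at h1
    exact hline.continuousAt.tendsto.eventually h1
  set γ' := e.symm (1, 0, 0)
  have hv : HasDerivAt (fun t => (γ t).2.1) γ'.2.1 0 :=
    (hasFDerivAt_fst (𝕜 := ℝ) (E := ι → ℂ) (F := ℂ)).comp_hasDerivAt (0 : ℝ)
      ((hasFDerivAt_snd (𝕜 := ℝ) (E := ℝ) (F := (ι → ℂ) × ℂ)).comp_hasDerivAt (0 : ℝ) hγ)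
  have hμ : HasDerivAt (fun t => (γ t).2.2) γ'.2.2 0 :=
    (hasFDerivAt_snd (𝕜 := ℝ) (E := ι → ℂ) (F := ℂ)).comp_hasDerivAt (0 : ℝ)
      ((hasFDerivAt_snd (𝕜 := ℝ) (E := ℝ) (F := (ι → ℂ) × ℂ)).comp_hasDerivAt (0 : ℝ) hγ)
  have hev : ∀ᶠ t : ℝ in 𝓝 0,
      U *ᵥ (fun s => Complex.exp (t * κ s) * (γ t).2.1 s) = (γ t).2.2 • (γ t).2.1 := by
    filter_upwards [hinv] with t ht
    have h1 : (γ t).1 = t := congrArg Prod.fst ht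
    have h2 : U *ᵥ (fun s => Complex.exp ((γ t).1 * κ s) * (γ t).2.1 s) -
        (γ t).2.2 • (γ t).2.1 = 0 := congrArg (fun x => x.2.1) ht
    rw [h1] at h2
    exact sub_eq_zero.1 h2
  refine ⟨fun t => (γ t).2.1, fun t => (γ t).2.2, γ'.2.1, γ'.2.2, by simp [hγ0], by simp [hγ0],
    hv, hμ, ?_, ?_, hev⟩
  · have h1 : HasDerivAt (fun t => star v₀ ⬝ᵥ (γ t).2.1) (star v₀ ⬝ᵥ γ'.2.1) 0 := by
      have := HasDerivAt.fun_sum (u := Finset.univ) fun s _ =>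
        ((hasDerivAt_pi.1 hv s).const_mul (star v₀ s))
      exact this
    have h2 : (fun t => star v₀ ⬝ᵥ (γ t).2.1) =ᶠ[𝓝 0] fun _ => (1 : ℂ) := by
      filter_upwards [hinv] with t ht
      exact congrArg (fun x => x.2.2) ht
    exact h1.unique ((hasDerivAt_const (0 : ℝ) (1 : ℂ)).congr_of_eventuallyEq h2)
  -- The relation between `v'` and `μ'` is the eigenvalue equation differentiated at `t = 0`.
  · have hvs := hasDerivAt_pi.1 hv
    have hprod : HasDerivAt (fun t : ℝ => fun s => Complex.exp (t * κ s) * (γ t).2.1 s)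
        (fun s => κ s * v₀ s + γ'.2.1 s) 0 := by
      refine hasDerivAt_pi.2 fun s => ?_
      have h1 : HasDerivAt (fun t : ℝ => (t : ℂ) * κ s) (κ s) 0 := by
        simpa using (Complex.ofRealCLM.hasDerivAt (x := (0 : ℝ))).mul_const (κ s)
      have h2 := h1.cexp.fun_mul (hvs s)
      simp only [hγ0, Complex.ofReal_zero, zero_mul, Complex.exp_zero, one_mul] at h2
      exact h2
    have hL : HasDerivAt (fun t : ℝ => U *ᵥ fun s => Complex.exp (t * κ s) * (γ t).2.1 s)
        (U *ᵥ fun s => κ s * v₀ s + γ'.2.1 s) 0 :=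
      ((Matrix.mulVecLin U).restrictScalars ℝ).toContinuousLinearMap.hasFDerivAt.comp_hasDerivAt
        (0 : ℝ) hprod
    have hR := hμ.smul hv
    have := hL.unique (hR.congr_of_eventuallyEq hev)
    rw [← Matrix.mulVec_add]
    simp only [hγ0] at this
    rw [add_comm (γ'.2.2 • v₀)]
    exact this

/-! ### Orthonormal eigenbases and generic unitaries -/

open scoped ComplexOrder in
theorem star_dotProduct_self_ne_zero {ι : Type*} [Fintype ι] {v : ι → ℂ} (hv : v ≠ 0) :
    star v ⬝ᵥ v ≠ 0 := by
  rwa [Ne, dotProduct_star_self_eq_zero]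

section Unitary

variable {ι : Type*} [Fintype ι] [DecidableEq ι] {U : Matrix ι ι ℂ}

theorem Matrix.star_mulVec_dotProduct_mulVec (hU : U ∈ Matrix.unitaryGroup ι ℂ) (x y : ι → ℂ) :
    star (U *ᵥ x) ⬝ᵥ (U *ᵥ y) = star x ⬝ᵥ y := by
  rw [Matrix.star_mulVec, ← Matrix.dotProduct_mulVec, Matrix.mulVec_mulVec,
    ← Matrix.star_eq_conjTranspose, (Matrix.mem_unitaryGroup_iff').1 hU, Matrix.one_mulVec]

theorem Matrix.star_mul_self_eigenvalue (hU : U ∈ Matrix.unitaryGroup ι ℂ) {v : ι → ℂ}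
    (hv : v ≠ 0) {μ : ℂ} (h : U *ᵥ v = μ • v) : star μ * μ = 1 := by
  have h1 := Matrix.star_mulVec_dotProduct_mulVec hU v v
  rw [h, star_smul, smul_dotProduct, dotProduct_smul, smul_eq_mul, smul_eq_mul, ← mul_assoc] at h1
  exact mul_right_cancel₀ (star_dotProduct_self_ne_zero hv) (by rw [h1, one_mul])

/-- An eigenvector of a unitary matrix is also a left eigenvector. -/
theorem Matrix.star_dotProduct_mulVec_eigenvector (hU : U ∈ Matrix.unitaryGroup ι ℂ) {v : ι → ℂ}
    (hv : v ≠ 0) {μ : ℂ} (h : U *ᵥ v = μ • v) (w : ι → ℂ) :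
    star v ⬝ᵥ (U *ᵥ w) = μ * (star v ⬝ᵥ w) := by
  have h0 := Matrix.star_mul_self_eigenvalue hU hv h
  have h1 : U *ᵥ (star μ • v) = v := by
    rw [Matrix.mulVec_smul, h, smul_smul, h0, one_smul]
  have h2 := Matrix.star_mulVec_dotProduct_mulVec hU (star μ • v) w
  rw [h1] at h2
  rw [h2, star_smul, star_star, smul_dotProduct, smul_eq_mul]

theorem Matrix.star_dotProduct_eigenvectors_eq_zero (hU : U ∈ Matrix.unitaryGroup ι ℂ)
    {v w : ι → ℂ} (hv : v ≠ 0) {μ ν : ℂ} (h : U *ᵥ v = μ • v) (h' : U *ᵥ w = ν • w) (hμν : μ ≠ ν) :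
    star v ⬝ᵥ w = 0 := by
  have h1 := Matrix.star_dotProduct_mulVec_eigenvector hU hv h w
  rw [h', dotProduct_smul, smul_eq_mul] at h1
  exact (mul_eq_zero.1 (show (μ - ν) * (star v ⬝ᵥ w) = 0 by rw [sub_mul, h1, sub_self])).resolve_left
    (sub_ne_zero.2 hμν)

/-- The family `v` is orthonormal for the standard inner product. -/
def IsOrthonormalFamily (v : ι → ι → ℂ) : Prop :=
  ∀ j k, star (v j) ⬝ᵥ v k = if j = k then 1 else 0

theorem IsOrthonormalFamily.ne_zero {v : ι → ι → ℂ} (hv : IsOrthonormalFamily v) (j : ι) :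
    v j ≠ 0 := by
  intro h
  have := hv j j
  rw [h] at this
  simp at this

theorem IsOrthonormalFamily.mem_unitaryGroup {v : ι → ι → ℂ} (hv : IsOrthonormalFamily v) :
    (Matrix.of fun s j => v j s) ∈ Matrix.unitaryGroup ι ℂ := by
  rw [Matrix.mem_unitaryGroup_iff']
  ext j k
  rw [Matrix.one_apply, ← hv j k]
  rfl

theorem IsOrthonormalFamily.eq_zero_of_forall {v : ι → ι → ℂ} (hv : IsOrthonormalFamily v)
    {w : ι → ℂ} (hw : ∀ j, star (v j) ⬝ᵥ w = 0) : w = 0 := by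
  have h1 : star (Matrix.of fun s j => v j s) *ᵥ w = 0 := funext hw
  have h2 := congrArg (fun x => (Matrix.of fun s j => v j s) *ᵥ x) h1
  simpa [Matrix.mulVec_mulVec, (Matrix.mem_unitaryGroup_iff).1 hv.mem_unitaryGroup] using h2

end Unitary

section Generic

variable {ι : Type*} [Fintype ι] [DecidableEq ι]

/-- `U` has an orthonormal eigenbasis such that products of pairs of eigenvalues are distinct and
the expectation values of the observable `diag(ζ)` in the eigenvectors are distinct. -/
def IsGeneric (U : Matrix ι ι ℂ) (ζ : ι → ℝ) : Prop :=
  ∃ (v : ι → ι → ℂ) (μ : ι → ℂ), (∀ j, U *ᵥ v j = μ j • v j) ∧ IsOrthonormalFamily v ∧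
    HasDistinctProducts μ ∧ Function.Injective fun j => star (v j) ⬝ᵥ fun s => ζ s * v j s

theorem IsGeneric.symDisc_ne_zero {U : Matrix ι ι ℂ} {ζ : ι → ℝ} (h : IsGeneric U ζ) :
    symDisc U ≠ 0 := by
  obtain ⟨v, μ, heig, hv, hμ, -⟩ := h
  refine (symDisc_ne_zero_iff hv.mem_unitaryGroup ?_).2 hμ
  ext s j
  rw [Matrix.mul_diagonal]
  have := congrFun (heig j) s
  rw [Pi.smul_apply, smul_eq_mul, mul_comm] at this
  exact this

/-- Perturbed eigenvectors are normalized only against the unperturbed one, so their norms vary.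
Rayleigh quotients are insensitive to this, and orthogonality is automatic because the eigenvalues
are distinct. -/
theorem IsGeneric.of_eigenvectors {U : Matrix ι ι ℂ} {ζ : ι → ℝ}
    (hU : U ∈ Matrix.unitaryGroup ι ℂ) {v : ι → ι → ℂ} {μ : ι → ℂ} (hv : ∀ j, v j ≠ 0)
    (heig : ∀ j, U *ᵥ v j = μ j • v j) (hμ : HasDistinctProducts μ)
    (hinj : Function.Injective fun j =>
      (star (v j) ⬝ᵥ fun s => ζ s * v j s) / (star (v j) ⬝ᵥ v j)) : IsGeneric U ζ := by
  have hreal : ∀ j, ∃ r : ℝ, 0 < r ∧ star (v j) ⬝ᵥ v j = (r : ℂ) ^ 2 := by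
    intro j
    have h1 : star (v j) ⬝ᵥ v j = ((∑ s, ‖v j s‖ ^ 2 : ℝ) : ℂ) := by
      push_cast
      exact Finset.sum_congr rfl fun s _ => Complex.conj_mul' _
    have h0 := star_dotProduct_self_ne_zero (hv j)
    rw [h1] at h0
    have h2 : 0 < ∑ s, ‖v j s‖ ^ 2 :=
      lt_of_le_of_ne (Finset.sum_nonneg fun s _ => by positivity) fun h => h0 (by rw [← h]; simp)
    refine ⟨√(∑ s, ‖v j s‖ ^ 2), Real.sqrt_pos.2 h2, ?_⟩
    rw [h1, ← Complex.ofReal_pow, Real.sq_sqrt h2.le]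
  choose r hr hr2 using hreal
  have hr0 : ∀ j, (r j : ℂ) ≠ 0 := fun j => Complex.ofReal_ne_zero.2 (hr j).ne'
  refine ⟨fun j => ((r j)⁻¹ : ℂ) • v j, μ, fun j => ?_, fun j k => ?_, hμ, ?_⟩
  · rw [Matrix.mulVec_smul, heig, smul_comm]
  · simp only [star_smul, smul_dotProduct, dotProduct_smul, smul_eq_mul]
    split_ifs with h
    · subst h
      rw [hr2, star_inv₀, RCLike.star_def, Complex.conj_ofReal]
      have := hr0 j
      field_simp
    · rw [Matrix.star_dotProduct_eigenvectors_eq_zero hU (hv j) (heig j) (heig k)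
        (fun h' => h (hμ.injective h'))]
      simp
  · convert hinj using 2 with j
    have h1 : (fun s => (ζ s : ℂ) * (((r j)⁻¹ : ℂ) • v j) s) =
        ((r j)⁻¹ : ℂ) • fun s => (ζ s : ℂ) * v j s := by
      ext s; simp; ring
    rw [h1, star_smul, smul_dotProduct, dotProduct_smul, hr2, star_inv₀, RCLike.star_def,
      Complex.conj_ofReal, smul_eq_mul, smul_eq_mul]
    have := hr0 j
    field_simp

theorem IsGeneric.reindex {κ : Type*} [Fintype κ] [DecidableEq κ] {U : Matrix ι ι ℂ} {ζ : ι → ℝ}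
    (h : IsGeneric U ζ) (e : κ ≃ ι) : IsGeneric (U.submatrix e e) (ζ ∘ e) := by
  obtain ⟨v, μ, heig, hv, hμ, hq⟩ := h
  have hdot : ∀ x y : ι → ℂ, (x ∘ e) ⬝ᵥ (y ∘ e) = x ⬝ᵥ y := fun x y =>
    e.sum_comp fun s => x s * y s
  refine ⟨fun j => v (e j) ∘ e, μ ∘ e, fun j => ?_, fun j k => ?_, ?_, ?_⟩
  · ext s
    have := congrFun (heig (e j)) (e s)
    simpa [Matrix.submatrix_mulVec_equiv, Function.comp_assoc] using this
  · have := hv (e j) (e k)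
    simp only [EmbeddingLike.apply_eq_iff_eq] at this
    rw [← this]
    exact hdot (star (v (e j))) (v (e k))
  · intro j k l m h
    simpa using hμ _ _ _ _ h
  · intro j k h
    refine e.injective (hq ?_)
    have h1 : ∀ j, (star (v (e j) ∘ e) ⬝ᵥ fun s => ((ζ ∘ e) s : ℂ) * (v (e j) ∘ e) s) =
        star (v (e j)) ⬝ᵥ fun s => (ζ s : ℂ) * v (e j) s := fun j =>
      hdot (star (v (e j))) fun s => (ζ s : ℂ) * v (e j) s
    simpa only [h1] using h

/-- First-order perturbation theory for the eigenvalues and eigenvectors of `U · diag(exp(t κ))`,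
where `U` is unitary with nondegenerate spectrum. -/
theorem exists_perturbed_eigenpair {U : Matrix ι ι ℂ} (hU : U ∈ Matrix.unitaryGroup ι ℂ)
    {v : ι → ι → ℂ} {μ : ι → ℂ} (heig : ∀ j, U *ᵥ v j = μ j • v j) (hv : IsOrthonormalFamily v)
    (hμ : Function.Injective μ) (κ : ι → ℂ) (j : ι) :
    ∃ (w : ℝ → ι → ℂ) (ν : ℝ → ℂ) (w' : ι → ℂ), w 0 = v j ∧ ν 0 = μ j ∧
      HasDerivAt w w' 0 ∧ HasDerivAt ν (μ j * (star (v j) ⬝ᵥ fun s => κ s * v j s)) 0 ∧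
      star (v j) ⬝ᵥ w' = 0 ∧
      (∀ k, k ≠ j → (star (v k) ⬝ᵥ w') * (μ j - μ k) =
        μ k * (star (v k) ⬝ᵥ fun s => κ s * v j s)) ∧
      ∀ᶠ t : ℝ in 𝓝 0, (U * Matrix.diagonal fun s => Complex.exp (t * κ s)) *ᵥ w t = ν t • w t := by
  have hleft : ∀ k w, star (v k) ⬝ᵥ (U *ᵥ w) = μ k * (star (v k) ⬝ᵥ w) := fun k w =>
    Matrix.star_dotProduct_mulVec_eigenvector hU (hv.ne_zero k) (heig k) w
  obtain ⟨w, ν, w', ν', hw0, hν0, hw, hν, horth, heq, hev⟩ :=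
    exists_eigenpair_branch U κ (heig j) (by simpa using hv j j) (by
      intro w c h1 h2
      have h3 : ∀ k, (μ k - μ j) * (star (v k) ⬝ᵥ w) = c * if k = j then 1 else 0 := by
        intro k
        have := congrArg (fun x => star (v k) ⬝ᵥ x) h1
        simp only [dotProduct_sub, dotProduct_smul, smul_eq_mul, hleft, hv k j] at this
        rw [sub_mul, this]
      have hc : c = 0 := by simpa using (h3 j).symm
      refine ⟨hv.eq_zero_of_forall fun k => ?_, hc⟩
      by_cases hk : k = j
      · rw [hk, h2]
      · have := h3 k
        rw [if_neg hk, mul_zero] at this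
        exact (mul_eq_zero.1 this).resolve_left (sub_ne_zero.2 fun h => hk (hμ h)))
  -- Pairing the differentiated equation with the left eigenvector `v k`: the case `k = j` yields
  -- the derivative of the eigenvalue, the cases `k ≠ j` the mixing coefficients.
  have hproj : ∀ k, μ k * (star (v k) ⬝ᵥ fun s => κ s * v j s) + μ k * (star (v k) ⬝ᵥ w') =
      ν' * (if k = j then 1 else 0) + μ j * (star (v k) ⬝ᵥ w') := by
    intro k
    have := congrArg (fun x => star (v k) ⬝ᵥ x) heq
    simpa only [dotProduct_add, dotProduct_smul, smul_eq_mul, hleft, hv k j] using this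
  have hν' : ν' = μ j * (star (v j) ⬝ᵥ fun s => κ s * v j s) := by
    have := hproj j
    rw [if_pos rfl, horth] at this
    linear_combination -this
  refine ⟨w, ν, w', hw0, hν0, hw, hν' ▸ hν, horth, fun k hk => ?_, ?_⟩
  · have := hproj k
    rw [if_neg hk] at this
    linear_combination -this
  · filter_upwards [hev] with t ht
    rw [← ht, ← Matrix.mulVec_mulVec]
    congr 1
    ext s
    rw [Matrix.mulVec_diagonal]

end Generic

theorem HasDerivAt.star_dotProduct_weighted {ι : Type*} [Fintype ι] (ζ : ι → ℂ)
    {w : ℝ → ι → ℂ} {w' : ι → ℂ} {t : ℝ}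
    (hw : HasDerivAt w w' t) : HasDerivAt (fun t => star (w t) ⬝ᵥ fun s => ζ s * w t s)
      ((star w' ⬝ᵥ fun s => ζ s * w t s) + star (w t) ⬝ᵥ fun s => ζ s * w' s) t := by
  have hs := hasDerivAt_pi.1 hw
  have h := HasDerivAt.fun_sum (u := Finset.univ) fun s _ =>
    (hs s).star.fun_mul ((hs s).const_mul (ζ s))
  rw [Finset.sum_add_distrib] at h
  exact h

/-- A difference that is nonzero at `t` stays so by continuity, and one with nonzero derivative
there vanishes at most at `t` itself nearby. All degeneracies below are lifted in one of these two
ways. -/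
theorem HasDerivAt.eventually_ne_of_ne {f g : ℝ → ℂ} {f' g' : ℂ} {t : ℝ} (hf : HasDerivAt f f' t)
    (hg : HasDerivAt g g' t) (h : f t ≠ g t ∨ f' ≠ g') : ∀ᶠ s in 𝓝[≠] t, f s ≠ g s := by
  rcases h with h | h
  · have := (hf.sub hg).continuousAt.eventually_ne (y := 0) (sub_ne_zero.2 h)
    filter_upwards [this.filter_mono nhdsWithin_le_nhds] with s hs
    exact sub_ne_zero.1 hs
  · have := (hf.sub hg).eventually_ne (c := 0) (sub_ne_zero.2 h)
    filter_upwards [this] with s hs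
    exact sub_ne_zero.1 hs

/-! ### Weak coupling of one more qubit -/

section Coupling

variable {ι : Type*} [Fintype ι]

theorem Fin.eq_or_eq_of_ne_two {i j k : Fin 2} (h : i ≠ j) : k = i ∨ k = j := by
  omega

/-- The product `e ⊗ v` of a vector of `ℂ²` and a vector of `ℂ^ι`. -/
def tensorVec (e : Fin 2 → ℂ) (v : ι → ℂ) : Fin 2 × ι → ℂ := fun x => e x.1 * v x.2

theorem star_tensorVec_dotProduct (e f : Fin 2 → ℂ) (v w : ι → ℂ) :
    star (tensorVec e v) ⬝ᵥ tensorVec f w = (star e ⬝ᵥ f) * (star v ⬝ᵥ w) := by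
  simp only [dotProduct, Fintype.sum_prod_type, Finset.sum_mul_sum, tensorVec, Pi.star_apply,
    star_mul']
  exact Finset.sum_congr rfl fun _ _ => Finset.sum_congr rfl fun _ _ => by ring

theorem kronecker_mulVec_tensorVec (u : Matrix (Fin 2) (Fin 2) ℂ) (V : Matrix ι ι ℂ)
    (f : Fin 2 → ℂ) (w : ι → ℂ) :
    (u ⊗ₖ V) *ᵥ tensorVec f w = tensorVec (u *ᵥ f) (V *ᵥ w) := by
  ext ⟨b, s⟩
  simp only [Matrix.mulVec, dotProduct, Fintype.sum_prod_type, Finset.sum_mul_sum, tensorVec,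
    Matrix.kroneckerMap_apply]
  exact Finset.sum_congr rfl fun _ _ => Finset.sum_congr rfl fun _ _ => by ring

/-- Products of two of the numbers `k₀, k₀⁻¹` and an element of `R` coincide only trivially if `k₀²`
and `k₀⁴` are not ratios of elements of `R`. -/
theorem products_eq_of_avoid {k : Fin 2 → ℂ} (hk : k 0 * k 1 = 1) {R : Set ℂ}
    (h2 : ∀ X ∈ R, ∀ Y ∈ R, k 0 ^ 2 * X ≠ Y) (h4 : ∀ X ∈ R, ∀ Y ∈ R, k 0 ^ 4 * X ≠ Y)
    {i j l m : Fin 2} {X Y : ℂ} (hX : X ∈ R) (hY : Y ∈ R) (h : k i * k j * X = k l * k m * Y) :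
    ((i = l ∧ j = m) ∨ (i = m ∧ j = l)) ∧ X = Y := by
  have hk' : k 1 * k 0 = 1 := by rw [mul_comm]; exact hk
  have key : ∀ X ∈ R, ∀ Y ∈ R, k 0 * k 0 * X = Y → False := fun X hX Y hY h =>
    h2 X hX Y hY (by rw [sq]; exact h)
  have key1 : ∀ X ∈ R, ∀ Y ∈ R, k 1 * k 1 * X = Y → False := fun X hX Y hY h =>
    key Y hY X hX (by
      rw [← h]; linear_combination X * (k 0 * k 1 + 1) * hk)
  have key2 : ∀ X ∈ R, ∀ Y ∈ R, k 0 * k 0 * X = k 1 * k 1 * Y → False := fun X hX Y hY h =>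
    h4 X hX Y hY (by linear_combination k 0 ^ 2 * h + Y * (k 0 * k 1 + 1) * hk)
  have hne : k 0 ≠ 0 := left_ne_zero_of_mul_eq_one hk
  have hne1 : k 1 ≠ 0 := right_ne_zero_of_mul_eq_one hk
  fin_cases i <;> fin_cases j <;> fin_cases l <;> fin_cases m <;>
    simp only [Fin.zero_eta, Fin.mk_one, Fin.isValue, hk, hk', one_mul] at h ⊢ <;>
    first
    | exact (key _ hX _ hY h).elim
    | exact (key _ hY _ hX h.symm).elim
    | exact (key1 _ hX _ hY h).elim
    | exact (key1 _ hY _ hX h.symm).elim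
    | exact (key2 _ hX _ hY h).elim
    | exact (key2 _ hY _ hX h.symm).elim
    | exact ⟨by simp, h⟩
    | exact ⟨by simp, mul_left_cancel₀ (by simp [hne, hne1]) h⟩

variable [DecidableEq ι]

/-- A generic system weakly coupled to an additional qubit is generic. -/
theorem exists_isGeneric_coupling {u : Matrix (Fin 2) (Fin 2) ℂ} {z : Fin 2 → ℝ}
    (hu : u ∈ Matrix.unitaryGroup (Fin 2) ℂ) {e : Fin 2 → Fin 2 → ℂ} {k : Fin 2 → ℂ}
    (heu : ∀ i, u *ᵥ e i = k i • e i) (he : IsOrthonormalFamily e) (hk : k 0 * k 1 = 1)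
    (hr : (star (e 0) ⬝ᵥ fun b => z b * e 0 b) ≠ star (e 1) ⬝ᵥ fun b => z b * e 1 b)
    (hγ : ∀ i, (star (e (i + 1)) ⬝ᵥ fun b => z b * e i b) ≠ 0)
    (hY : ∀ i, (Complex.I * (k (i + 1) / (k i - k (i + 1)))).re ≠ 0)
    {V : Matrix ι ι ℂ} (hV : V ∈ Matrix.unitaryGroup ι ℂ) {ζ : ι → ℝ}
    {v : ι → ι → ℂ} {μ : ι → ℂ} (heV : ∀ a, V *ᵥ v a = μ a • v a) (hv : IsOrthonormalFamily v)
    (hμ : HasDistinctProducts μ)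
    (hq : Function.Injective fun a => star (v a) ⬝ᵥ fun s => ζ s * v a s)
    (h2 : ∀ a b c d, k 0 ^ 2 * (μ a * μ b) ≠ μ c * μ d)
    (h4 : ∀ a b c d, k 0 ^ 4 * (μ a * μ b) ≠ μ c * μ d) :
    ∃ t : ℝ, IsGeneric ((u ⊗ₖ V) * Matrix.diagonal fun x : Fin 2 × ι =>
      Complex.exp (t * (-(Complex.I / 2) * (z x.1 * ζ x.2)))) (fun x => z x.1) := by
  set r : Fin 2 → ℂ := fun i => star (e i) ⬝ᵥ fun b => z b * e i b with hrdef
  set q : ι → ℂ := fun a => star (v a) ⬝ᵥ fun s => ζ s * v a s with hqdef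
  set γ : Fin 2 → ℂ := fun i => star (e (i + 1)) ⬝ᵥ fun b => z b * e i b with hγdef
  have hi1 : ∀ i : Fin 2, i + 1 ≠ i := by decide
  have hU : u ⊗ₖ V ∈ Matrix.unitaryGroup (Fin 2 × ι) ℂ := Matrix.kronecker_mem_unitary hu hV
  let w : Fin 2 × ι → Fin 2 × ι → ℂ := fun J => tensorVec (e J.1) (v J.2)
  let lam : Fin 2 × ι → ℂ := fun J => k J.1 * μ J.2
  have heig : ∀ J, (u ⊗ₖ V) *ᵥ w J = lam J • w J := by
    intro J
    rw [kronecker_mulVec_tensorVec, heu, heV]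
    ext x
    simp [tensorVec, w, lam]
    ring
  have hw : IsOrthonormalFamily w := by
    intro J K
    rw [star_tensorVec_dotProduct, he, hv]
    simp only [Prod.ext_iff]
    split_ifs <;> simp_all
  -- At zero coupling a coincidence permutes the qubit labels and the system labels, each trivially
  -- but independently of each other; mismatched permutations are the degeneracies still to be
  -- lifted.
  have hprod : ∀ J K L M, lam J * lam K = lam L * lam M →
      ((J.1 = L.1 ∧ K.1 = M.1) ∨ (J.1 = M.1 ∧ K.1 = L.1)) ∧
      ((J.2 = L.2 ∧ K.2 = M.2) ∨ (J.2 = M.2 ∧ K.2 = L.2)) := by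
    intro J K L M h
    have h' : k J.1 * k K.1 * (μ J.2 * μ K.2) = k L.1 * k M.1 * (μ L.2 * μ M.2) := by
      simp only [lam] at h
      linear_combination h
    obtain ⟨h1, h3⟩ := products_eq_of_avoid hk (R := {X | ∃ a b, X = μ a * μ b})
      (by rintro _ ⟨a, b, rfl⟩ _ ⟨c, d, rfl⟩; exact h2 a b c d)
      (by rintro _ ⟨a, b, rfl⟩ _ ⟨c, d, rfl⟩; exact h4 a b c d) ⟨_, _, rfl⟩ ⟨_, _, rfl⟩ h'
    exact ⟨h1, hμ _ _ _ _ h3⟩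
  have hlam : Function.Injective lam := by
    intro J K h
    have := hprod J J K J (by rw [h])
    ext <;> [rcases this.1 with h | h; rcases this.2 with h | h] <;> simp [h.1, h.2]
  set κ : Fin 2 × ι → ℂ := fun x => -(Complex.I / 2) * (z x.1 * ζ x.2) with hκ
  choose W ν W' hW0 hν0 hW hν horth hcross hev using
    exists_perturbed_eigenpair hU heig hw hlam κ
  have hκw : ∀ J : Fin 2 × ι, (fun s => κ s * w J s) =
      (-(Complex.I / 2)) • tensorVec (fun b => z b * e J.1 b) (fun s => ζ s * v J.2 s) := by
    intro J
    ext x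
    simp [hκ, w, tensorVec]
    ring
  have hν' : ∀ J, HasDerivAt (ν J) (lam J * (-(Complex.I / 2) * (r J.1 * q J.2))) 0 := by
    intro J
    have := hν J
    rwa [hκw, dotProduct_smul, star_tensorVec_dotProduct, smul_eq_mul] at this
  have hqreal : ∀ a, star (q a) = q a := by
    intro a
    simp only [hqdef, dotProduct, star_sum, star_mul', Pi.star_apply, RCLike.star_def,
      Complex.conj_ofReal, Complex.conj_conj]
    exact Finset.sum_congr rfl fun s _ => by ring
  -- The new observable acts on the qubit alone, so it links `(i, a)` only to its partner `(i + 1,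
  -- a)`, where `i + 1` in `Fin 2` is the other level. Only that one mixing coefficient enters the
  -- first-order change below.
  have hzw : ∀ J : Fin 2 × ι, (fun x => (z x.1 : ℂ) * w J x) =
      r J.1 • w J + γ J.1 • w (J.1 + 1, J.2) := by
    rintro ⟨i, a⟩
    have hex : (fun b => (z b : ℂ) * e i b) - r i • e i - γ i • e (i + 1) = 0 := by
      refine he.eq_zero_of_forall fun l => ?_
      rw [dotProduct_sub, dotProduct_sub, dotProduct_smul, dotProduct_smul, he, he]
      rcases Fin.eq_or_eq_of_ne_two (k := l) (hi1 i).symm with rfl | rfl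
      · rw [if_pos rfl, if_neg (hi1 _).symm]; simp [hrdef]
      · rw [if_neg (hi1 _), if_pos rfl]; simp [hγdef]
    ext ⟨b, s⟩
    have := congrFun hex b
    simp only [Pi.sub_apply, Pi.smul_apply, smul_eq_mul, Pi.zero_apply] at this
    simp only [w, tensorVec, Pi.add_apply, Pi.smul_apply, smul_eq_mul]
    linear_combination v a s * this
  -- The first-order change of the new expectation value in the state `(i, a)` is `q a * D i`: the
  -- system factor `μ a` cancels from the eigenvalue gap. Nonvanishing of `D i` is exactly what `hγ`
  -- and `hY` provide.
  set D : Fin 2 → ℂ := fun i => star (γ i) * γ i *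
    ((-(Complex.I / 2)) * (k (i + 1) / (k i - k (i + 1))) +
      star ((-(Complex.I / 2)) * (k (i + 1) / (k i - k (i + 1))))) with hD
  have hD0 : ∀ i, D i ≠ 0 := by
    intro i
    refine mul_ne_zero (mul_ne_zero (star_ne_zero.2 (hγ i)) (hγ i)) ?_
    intro h
    apply hY i
    have h1 := congrArg Complex.re h
    rw [Complex.add_re, RCLike.star_def, Complex.conj_re, Complex.zero_re] at h1
    have h3 : (-(Complex.I / 2)) * (k (i + 1) / (k i - k (i + 1))) =
      ((-(1 / 2) : ℝ) : ℂ) * (Complex.I * (k (i + 1) / (k i - k (i + 1)))) := by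
      push_cast; ring
    rw [h3, Complex.re_ofReal_mul] at h1
    linarith
  have hkne : ∀ i, k i - k (i + 1) ≠ 0 := by
    intro i h
    apply hY i
    rw [h]; simp
  have hμ0 : ∀ a, μ a ≠ 0 := fun a h => h2 a a a a (by rw [h]; simp)
  have hN' : ∀ J : Fin 2 × ι,
      HasDerivAt (fun t => (star (W J t) ⬝ᵥ fun x => (z x.1 : ℂ) * W J t x) /
        (star (W J t) ⬝ᵥ W J t)) (q J.2 * D J.1) 0 := by
    intro J
    have h0 : star (W J 0) ⬝ᵥ W J 0 = 1 := by rw [hW0, hw, if_pos rfl]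
    have hn := (hW J).star_dotProduct_weighted fun x => (z x.1 : ℂ)
    have hX : (star (w (J.1 + 1, J.2)) ⬝ᵥ W' J) =
        q J.2 * γ J.1 * ((-(Complex.I / 2)) * (k (J.1 + 1) / (k J.1 - k (J.1 + 1)))) := by
      have h := hcross J (J.1 + 1, J.2) (fun h => hi1 _ (congrArg Prod.fst h))
      rw [hκw, dotProduct_smul, star_tensorVec_dotProduct, smul_eq_mul] at h
      have h' : (star (w (J.1 + 1, J.2)) ⬝ᵥ W' J) * (k J.1 - k (J.1 + 1)) =
          k (J.1 + 1) * (-(Complex.I / 2) * (γ J.1 * q J.2)) := by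
        refine mul_right_cancel₀ (hμ0 J.2) ?_
        simp only [lam] at h
        linear_combination h
      have := hkne J.1
      rw [← mul_right_inj' this]
      rw [mul_comm, h']
      field_simp
    have hbra : (star (w J) ⬝ᵥ fun x => (z x.1 : ℂ) * W' J x) =
        star (γ J.1) * (star (w (J.1 + 1, J.2)) ⬝ᵥ W' J) := by
      have h1 : (star (w J) ⬝ᵥ fun x => (z x.1 : ℂ) * W' J x) =
          star (fun x => (z x.1 : ℂ) * w J x) ⬝ᵥ W' J := by
        simp only [dotProduct, Pi.star_apply, star_mul', RCLike.star_def, Complex.conj_ofReal]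
        exact Finset.sum_congr rfl fun s _ => by ring
      rw [h1, hzw, star_add, star_smul, star_smul, add_dotProduct, smul_dotProduct,
        smul_dotProduct, horth, smul_zero, zero_add, smul_eq_mul]
    have hket : (star (W' J) ⬝ᵥ fun x => (z x.1 : ℂ) * w J x) =
        star (star (w J) ⬝ᵥ fun x => (z x.1 : ℂ) * W' J x) := by
      simp only [dotProduct, Pi.star_apply, star_sum, star_mul', RCLike.star_def,
        Complex.conj_ofReal, Complex.conj_conj]
      exact Finset.sum_congr rfl fun s _ => by ring
    have hket' : star (W' J) ⬝ᵥ w J = star (star (w J) ⬝ᵥ W' J) := by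
      rw [Matrix.star_dotProduct]
    have hd : HasDerivAt (fun t => star (W J t) ⬝ᵥ W J t) 0 0 := by
      have h := (hW J).star_dotProduct_weighted fun _ => 1
      simp only [one_mul, hW0] at h
      convert h using 1
      exact ((congrArg₂ (· + ·) hket' (horth J)).trans (by rw [horth]; simp)).symm
    rw [hW0, hket, hbra, hX] at hn
    refine (hn.div hd (by rw [h0]; exact one_ne_zero)).congr_deriv ?_
    rw [h0]
    simp only [D, star_mul', star_star, hqreal]
    ring
  have hN0 : ∀ J : Fin 2 × ι, (star (W J 0) ⬝ᵥ fun x => (z x.1 : ℂ) * W J 0 x) /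
        (star (W J 0) ⬝ᵥ W J 0) = r J.1 := by
    intro J
    rw [hW0, hw, if_pos rfl, div_one, hzw, dotProduct_add, dotProduct_smul, dotProduct_smul, hw,
      hw, if_pos rfl, if_neg (fun h => hi1 _ (congrArg Prod.fst h).symm)]
    simp
  have hrne : ∀ i j, i ≠ j → r i ≠ r j := by
    intro i j hij
    fin_cases i <;> fin_cases j
    · exact absurd rfl hij
    · exact hr
    · exact hr.symm
    · exact absurd rfl hij
  -- Different qubit levels are separated already at `t = 0` by `r`; within a level the derivatives
  -- `q a * D i` differ because `q` is injective.
  have hinj : ∀ᶠ t : ℝ in 𝓝[≠] 0, Function.Injective fun J =>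
      (star (W J t) ⬝ᵥ fun x => (z x.1 : ℂ) * W J t x) / (star (W J t) ⬝ᵥ W J t) := by
    have h1 : ∀ J K, ∀ᶠ t : ℝ in 𝓝[≠] 0, J ≠ K →
        (star (W J t) ⬝ᵥ fun x => (z x.1 : ℂ) * W J t x) / (star (W J t) ⬝ᵥ W J t) ≠
        (star (W K t) ⬝ᵥ fun x => (z x.1 : ℂ) * W K t x) / (star (W K t) ⬝ᵥ W K t) := by
      intro J K
      by_cases hJK : J = K
      · exact Eventually.of_forall fun t h => absurd hJK h
      refine ((hN' J).eventually_ne_of_ne (hN' K) ?_).mono fun t h _ => h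
      rw [hN0, hN0]
      by_cases h1 : J.1 = K.1
      · right
        rw [h1]
        intro h3
        exact hJK (Prod.ext h1 (hq (mul_right_cancel₀ (hD0 _) h3)))
      · exact Or.inl (hrne _ _ h1)
    filter_upwards [eventually_all.2 fun J => eventually_all.2 (h1 J)] with t ht J K h
    by_contra hJK
    exact ht J K hJK h
  -- The two sides agree at `t = 0`, and their logarithmic derivatives differ there by `-(i/2) (r i
  -- - r j) (q a - q b)`.
  have hsplit : ∀ i j a b, i ≠ j → a ≠ b → ∀ᶠ t : ℝ in 𝓝[≠] 0,
      ν (i, a) t * ν (j, b) t ≠ ν (i, b) t * ν (j, a) t := by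
    intro i j a b hij hab
    refine ((hν' (i, a)).mul (hν' (j, b))).eventually_ne_of_ne
      ((hν' (i, b)).mul (hν' (j, a))) (Or.inr ?_)
    simp only [hν0, lam]
    intro h
    have hk0 : ∀ i, k i ≠ 0 := by
      intro i; fin_cases i
      · exact left_ne_zero_of_mul_eq_one hk
      · exact right_ne_zero_of_mul_eq_one hk
    have h3 : k i * μ a * (k j * μ b) * (Complex.I / 2) * ((r i - r j) * (q a - q b)) = 0 := by
      linear_combination -h
    have h5 : k i * μ a * (k j * μ b) * (Complex.I / 2) ≠ 0 := by
      simp [hk0, hμ0]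
    rcases mul_eq_zero.1 ((mul_eq_zero.1 h3).resolve_left h5) with h6 | h6
    · exact hrne i j hij (sub_eq_zero.1 h6)
    · exact hab (hq (sub_eq_zero.1 h6))
  have hdp : ∀ᶠ t : ℝ in 𝓝[≠] 0, HasDistinctProducts fun J => ν J t := by
    have h1 : ∀ J K L M, ∀ᶠ t : ℝ in 𝓝[≠] 0, ν J t * ν K t = ν L t * ν M t →
        (J = L ∧ K = M) ∨ (J = M ∧ K = L) := by
      intro J K L M
      by_cases h0 : lam J * lam K = lam L * lam M
      · obtain ⟨i, a⟩ := J
        obtain ⟨j, b⟩ := K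
        obtain ⟨l, c⟩ := L
        obtain ⟨m, d⟩ := M
        obtain ⟨h1, h3⟩ := hprod _ _ _ _ h0
        simp only at h1 h3
        by_cases hab : a = b
        · refine Eventually.of_forall fun t _ => ?_
          subst hab
          rcases h1 with ⟨rfl, rfl⟩ | ⟨rfl, rfl⟩ <;> rcases h3 with ⟨rfl, rfl⟩ | ⟨rfl, rfl⟩ <;> simp
        by_cases hij : i = j
        · refine Eventually.of_forall fun t _ => ?_
          subst hij
          rcases h1 with ⟨rfl, rfl⟩ | ⟨rfl, rfl⟩ <;> rcases h3 with ⟨rfl, rfl⟩ | ⟨rfl, rfl⟩ <;> simp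
        rcases h1 with ⟨rfl, rfl⟩ | ⟨rfl, rfl⟩ <;> rcases h3 with ⟨rfl, rfl⟩ | ⟨rfl, rfl⟩
        · exact Eventually.of_forall fun t _ => by simp
        · exact (hsplit i j a b hij hab).mono fun t ht h => absurd h ht
        · exact (hsplit i j a b hij hab).mono fun t ht h => absurd (h.trans (mul_comm _ _)) ht
        · exact Eventually.of_forall fun t _ => by simp
      · refine (((hν' J).mul (hν' K)).eventually_ne_of_ne ((hν' L).mul (hν' M))
          (Or.inl ?_)).mono fun t ht h => absurd h ht
        simpa only [Pi.mul_apply, hν0] using h0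
    filter_upwards [eventually_all.2 fun J => eventually_all.2 fun K => eventually_all.2 fun L =>
      eventually_all.2 (h1 J K L)] with t ht J K L M h
    exact ht J K L M h
  have hne : ∀ᶠ t : ℝ in 𝓝[≠] 0, ∀ J, W J t ≠ 0 := by
    refine eventually_all.2 fun J => ?_
    refine ((hW J).continuousAt.eventually_ne ?_).filter_mono nhdsWithin_le_nhds
    rw [hW0]
    exact hw.ne_zero J
  have hevs : ∀ᶠ t : ℝ in 𝓝[≠] 0, ∀ J, ((u ⊗ₖ V) * Matrix.diagonal fun x =>
      Complex.exp (t * κ x)) *ᵥ W J t = ν J t • W J t :=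
    (eventually_all.2 hev).filter_mono nhdsWithin_le_nhds
  obtain ⟨t, h1, h3, h5, h6⟩ := (hinj.and (hdp.and (hne.and hevs))).exists
  refine ⟨t, IsGeneric.of_eigenvectors (mul_mem hU ?_) h5 h6 h3 h1⟩
  rw [Matrix.mem_unitaryGroup_iff', Matrix.star_eq_conjTranspose, Matrix.diagonal_conjTranspose,
    Matrix.diagonal_mul_diagonal, ← Matrix.diagonal_one]
  congr 1
  ext x
  have hre : ((t : ℂ) * κ x).re = 0 := by
    have : (t : ℂ) * κ x = ((-(t * (z x.1 * ζ x.2) / 2) : ℝ) : ℂ) * Complex.I := by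
      simp only [hκ]; push_cast; ring
    rw [this]; simp
  rw [Pi.star_apply, RCLike.star_def, Complex.conj_mul', Complex.norm_exp, hre]
  simp

end Coupling

/-! ### One-qubit gates in general position -/

namespace KickedIsing

/-- The matrix `exp(-i (h/2) σˣ)`. -/
def kickGate (h : ℝ) : Matrix (Fin 2) (Fin 2) ℂ :=
  !![(Real.cos (h / 2) : ℂ), -Complex.I * Real.sin (h / 2);
    -Complex.I * Real.sin (h / 2), (Real.cos (h / 2) : ℂ)]

/-- The matrix `exp(-i (h/2) σᶻ)`. -/
def phaseGate (h : ℝ) : Matrix (Fin 2) (Fin 2) ℂ :=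
  Matrix.diagonal fun b => Complex.exp (-(Complex.I / 2) * (h * zval b))

theorem kickGate_mem_unitaryGroup (h : ℝ) : kickGate h ∈ Matrix.unitaryGroup (Fin 2) ℂ := by
  have hcs : (Real.cos (h / 2) : ℂ) ^ 2 + (Real.sin (h / 2) : ℂ) ^ 2 = 1 := by
    exact_mod_cast Real.cos_sq_add_sin_sq (h / 2)
  rw [Matrix.mem_unitaryGroup_iff]
  ext i j
  fin_cases i <;> fin_cases j <;>
    simp only [kickGate, Matrix.mul_apply, Fin.sum_univ_two, Matrix.star_apply, Fin.zero_eta,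
      Fin.mk_one, Matrix.of_apply, Matrix.cons_val_zero, Matrix.cons_val_one, Matrix.cons_val',
      Matrix.cons_val_fin_one, RCLike.star_def, map_mul, map_neg, Complex.conj_I,
      Complex.conj_ofReal, Fin.isValue, Matrix.one_apply_eq, ne_eq, one_ne_zero, zero_ne_one,
      not_false_eq_true, Matrix.one_apply_ne, neg_neg] <;>
    first
    | ring1
    | linear_combination hcs - (Real.sin (h / 2) : ℂ) ^ 2 * Complex.I_sq

theorem phaseGate_mem_unitaryGroup (h : ℝ) : phaseGate h ∈ Matrix.unitaryGroup (Fin 2) ℂ := by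
  rw [phaseGate, Matrix.mem_unitaryGroup_iff', Matrix.star_eq_conjTranspose,
    Matrix.diagonal_conjTranspose, Matrix.diagonal_mul_diagonal, ← Matrix.diagonal_one]
  congr 1
  ext x
  have hre : (-(Complex.I / 2) * (h * zval x) : ℂ).re = 0 := by
    have : (-(Complex.I / 2) * (h * zval x) : ℂ) =
        ((-(h * zval x / 2) : ℝ) : ℂ) * Complex.I := by
      push_cast; ring
    rw [this]; simp
  rw [Pi.star_apply, RCLike.star_def, Complex.conj_mul', Complex.norm_exp, hre]
  simp

/-- One-qubit gates whose spectrum avoids a given finite set and whose eigenvectors are in general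
position with respect to `σᶻ`. -/
theorem exists_qubit_gate {R : Set ℂ} (hR : R.Finite) :
    ∃ (a b : ℝ) (e : Fin 2 → Fin 2 → ℂ) (k : Fin 2 → ℂ),
      (∀ i, (kickGate a * phaseGate b) *ᵥ e i = k i • e i) ∧ IsOrthonormalFamily e ∧
      k 0 * k 1 = 1 ∧
      (star (e 0) ⬝ᵥ fun b => zval b * e 0 b) ≠ (star (e 1) ⬝ᵥ fun b => zval b * e 1 b) ∧
      (∀ i, (star (e (i + 1)) ⬝ᵥ fun b => zval b * e i b) ≠ 0) ∧
      (∀ i, (Complex.I * (k (i + 1) / (k i - k (i + 1)))).re ≠ 0) ∧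
      k 0 ^ 2 ∉ R ∧ k 0 ^ 4 ∉ R := by
  set c : ℝ := Real.cos (Real.pi / 4) with hc
  set s : ℝ := Real.sin (Real.pi / 4) with hs
  have hc0 : 0 < c := by rw [hc, Real.cos_pi_div_four]; positivity
  have hs0 : 0 < s := by rw [hs, Real.sin_pi_div_four]; positivity
  have hcs : c ^ 2 + s ^ 2 = 1 := Real.cos_sq_add_sin_sq _
  have hc1 : c < 1 := by nlinarith
  have hbad : (Complex.re '' ((fun w : ℂ => w ^ 2) ⁻¹' R ∪ (fun w : ℂ => w ^ 4) ⁻¹' R)).Finite := by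
    have hpow : ∀ n : ℕ, 0 < n → ((fun w : ℂ => w ^ n) ⁻¹' R).Finite := fun n hn =>
      hR.preimage' fun b _ =>
        (Polynomial.nthRoots n b).toFinset.finite_toSet.subset fun w hw => by
          simpa [Polynomial.mem_nthRoots hn] using hw
    exact ((hpow 2 (by norm_num)).union (hpow 4 (by norm_num))).image _
  -- The kick angle is fixed and the phase angle is tuned so that the trace is `2x`, making `x` the
  -- real part of both eigenvalues. Only finitely many `x` put `k 0 ^ 2` or `k 0 ^ 4` into `R`. The
  -- bound `x < c` keeps `sin η` and the imaginary part nonzero; `x > 0` is needed for the real-part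
  -- condition.
  obtain ⟨x, ⟨hx0, hxc⟩, hx⟩ := ((Set.Ioo_infinite hc0).sdiff hbad).nonempty
  set η : ℝ := Real.arccos (x / c) with hη
  have hxc0 : 0 < x / c := div_pos hx0 hc0
  have hxc1 : x / c < 1 := (div_lt_one hc0).2 hxc
  have hcos : c * Real.cos η = x := by
    rw [hη, Real.cos_arccos (by linarith) hxc1.le]; field_simp
  have hsin : Real.sin η ≠ 0 := by
    rw [hη, Real.sin_arccos]
    exact (Real.sqrt_pos.2 (by nlinarith)).ne'
  set u := kickGate (Real.pi / 2) * phaseGate (2 * η) with hu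
  have huU : u ∈ Matrix.unitaryGroup (Fin 2) ℂ :=
    mul_mem (kickGate_mem_unitaryGroup _) (phaseGate_mem_unitaryGroup _)
  set E : ℂ := Complex.exp (Complex.I * η) with hE
  set E' : ℂ := Complex.exp (-(Complex.I * η)) with hE'
  have hEE : E' * E = 1 := by rw [hE, hE', ← Complex.exp_add]; simp
  have hEsum : E' + E = 2 * Real.cos η := by
    rw [hE, hE', Complex.ofReal_cos, Complex.cos]; ring_nf
  have hEdiff : E' - E = -2 * Complex.I * Real.sin η := by
    rw [hE, hE', Complex.ofReal_sin, Complex.sin]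
    ring_nf
    rw [Complex.I_sq]; ring
  have hE0 : E ≠ 0 := Complex.exp_ne_zero _
  have hE'0 : E' ≠ 0 := Complex.exp_ne_zero _
  have hpi : Real.pi / 2 / 2 = Real.pi / 4 := by ring
  have hu' : u = !![c * E', -Complex.I * s * E; -Complex.I * s * E', c * E] := by
    have hph : (fun b => Complex.exp (-(Complex.I / 2) * ((2 * η : ℝ) * zval b))) = ![E', E] := by
      ext b
      fin_cases b <;>
        simp only [zval, hE, hE', Fin.zero_eta, Fin.mk_one, Fin.isValue, if_true, one_ne_zero,
          if_false, Matrix.cons_val_zero, Matrix.cons_val_one] <;>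
        congr 1 <;> push_cast <;> ring
    rw [hu, kickGate, hpi, ← hc, ← hs, phaseGate, hph]
    ext i j
    rw [Matrix.mul_diagonal]
    fin_cases i <;> fin_cases j <;> simp
  have hs' : (s : ℂ) ≠ 0 := by exact_mod_cast hs0.ne'
  have hc' : (c : ℂ) ≠ 0 := by exact_mod_cast hc0.ne'
  have hdet : u.det = 1 := by
    rw [hu', Matrix.det_fin_two_of]
    have : (c : ℂ) ^ 2 + (s : ℂ) ^ 2 = 1 := by exact_mod_cast hcs
    linear_combination this + (c ^ 2 - Complex.I ^ 2 * s ^ 2) * hEE - (s : ℂ) ^ 2 * Complex.I_sq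
  have htr : u.trace = 2 * x := by
    rw [hu', Matrix.trace_fin_two_of, ← hcos, Complex.ofReal_mul]
    linear_combination (c : ℂ) * hEsum
  obtain ⟨W, hW, k, hWk⟩ := Matrix.exists_diagonalization_of_mem_unitaryGroup huU
  set e : Fin 2 → Fin 2 → ℂ := fun i b => W b i with he
  have hW1 : star W * W = 1 := Matrix.mem_unitaryGroup_iff'.1 hW
  have hW2 : W * star W = 1 := Matrix.mem_unitaryGroup_iff.1 hW
  have heu : ∀ i, u *ᵥ e i = k i • e i := by
    intro i
    ext b
    have := congrFun (congrFun hWk b) i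
    rw [Matrix.mul_diagonal] at this
    rw [Pi.smul_apply, smul_eq_mul, mul_comm]
    exact this
  have heo : IsOrthonormalFamily e := by
    intro i j
    have := congrFun (congrFun hW1 i) j
    rw [Matrix.one_apply] at this
    exact this
  have hconj : u = W * Matrix.diagonal k * star W := by
    rw [← hWk, mul_assoc, hW2, mul_one]
  have hkdet : k 0 * k 1 = 1 := by
    rw [← hdet, hconj, mul_assoc, Matrix.det_mul_comm, mul_assoc, hW1, mul_one, Matrix.det_diagonal,
      Fin.prod_univ_two]
  have hktr : k 0 + k 1 = 2 * x := by
    rw [← htr, hconj, mul_assoc, Matrix.trace_mul_comm, mul_assoc, hW1, mul_one,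
      Matrix.trace_diagonal, Fin.sum_univ_two]
  have hx1 : x < 1 := hxc.trans hc1
  have hne : ∀ i, e i ≠ 0 := heo.ne_zero
  have hk1 : k 1 = star (k 0) := by
    have h0 := Matrix.star_mul_self_eigenvalue huU (hne 0) (heu 0)
    have h1 : k 0 ≠ 0 := left_ne_zero_of_mul_eq_one hkdet
    exact mul_left_cancel₀ h1 (by rw [hkdet, ← h0, mul_comm])
  have hre : (k 0).re = x := by
    have := congrArg Complex.re hktr
    rw [hk1, Complex.add_re, RCLike.star_def, Complex.conj_re, ← Complex.ofReal_ofNat,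
      Complex.re_ofReal_mul, Complex.ofReal_re] at this
    linarith
  set y : ℝ := (k 0).im with hy
  have hxy : x ^ 2 + y ^ 2 = 1 := by
    have h0 := congrArg Complex.re hkdet
    rw [hk1, RCLike.star_def, Complex.mul_conj, Complex.ofReal_re, Complex.normSq_apply, hre,
      Complex.one_re] at h0
    rw [← h0]; ring
  have hy0 : y ≠ 0 := by
    rintro h
    rw [h] at hxy
    nlinarith
  have hy0' : (y : ℂ) ≠ 0 := by exact_mod_cast hy0
  have hk01 : k 0 - k 1 = 2 * y * Complex.I := by
    rw [hk1, RCLike.star_def, Complex.sub_conj]; push_cast; ring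
  have hre1 : (k 1).re = x := by rw [hk1, RCLike.star_def, Complex.conj_re, hre]
  set r : Fin 2 → ℂ := fun i => star (e i) ⬝ᵥ fun b => zval b * e i b with hr
  set Z : Matrix (Fin 2) (Fin 2) ℂ := Matrix.diagonal fun b => (zval b : ℂ) with hZ
  have hrW : ∀ i, r i = (star W * (Z * W)) i i := by
    intro i
    rw [Matrix.mul_apply]
    simp only [hZ, Matrix.diagonal_mul]
    rfl
  have hrsum : r 0 + r 1 = 0 := by
    have : (star W * (Z * W)).trace = 0 := by
      rw [Matrix.trace_mul_comm, mul_assoc, hW2, mul_one, hZ, Matrix.trace_diagonal]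
      simp [zval]
    rw [Matrix.trace, Fin.sum_univ_two, Matrix.diag_apply, Matrix.diag_apply] at this
    rw [hrW, hrW, this]
  -- This is the trace of `Z * u`. Together with `r 0 + r 1 = 0` it excludes `r 0 = r 1`, since
  -- equality would make both zero while `E' - E ≠ 0`.
  have hrk : r 0 * k 0 + r 1 * k 1 = c * (E' - E) := by
    have h1 : (star W * (Z * W) * Matrix.diagonal k).trace = (Z * u).trace := by
      rw [hconj, Matrix.trace_mul_comm, ← mul_assoc, Matrix.trace_mul_comm, mul_assoc, mul_assoc]
    rw [Matrix.trace, Fin.sum_univ_two, Matrix.diag_apply, Matrix.diag_apply, Matrix.mul_diagonal,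
      Matrix.mul_diagonal, ← hrW, ← hrW] at h1
    rw [h1, Matrix.trace, Fin.sum_univ_two, Matrix.diag_apply, Matrix.diag_apply, hZ,
      Matrix.diagonal_mul, Matrix.diagonal_mul, hu']
    simp [zval]
    ring
  refine ⟨Real.pi / 2, 2 * η, e, k, heu, heo, hkdet, ?_, ?_, ?_, ?_, ?_⟩
  · intro h
    change r 0 = r 1 at h
    have h0 : r 1 = 0 := by rw [h] at hrsum; linear_combination hrsum / 2
    rw [h, h0, hEdiff] at hrk
    simp [hc0.ne'] at hrk
    exact hsin (by exact_mod_cast hrk)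
  -- Without an off-diagonal element `e i` would be an eigenvector of `σᶻ`, hence a multiple of a
  -- basis vector, which `u` does not preserve because its off-diagonal entries are nonzero.
  · intro i h
    have hker : (fun b => (zval b : ℂ) * e i b) - r i • e i = 0 := by
      refine heo.eq_zero_of_forall fun l => ?_
      rw [dotProduct_sub, dotProduct_smul, heo]
      rcases Fin.eq_or_eq_of_ne_two (i := i) (j := i + 1) (k := l) (by omega) with rfl | rfl
      · simp [hr]
      · rw [h, if_neg (by omega)]; simp
    have hz0 : (1 - r i) * e i 0 = 0 := by
      have := congrFun hker 0
      simp [zval] at this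
      linear_combination this
    have hz1 : (-1 - r i) * e i 1 = 0 := by
      have := congrFun hker 1
      simp [zval] at this
      linear_combination this
    have hu0 := congrFun (heu i) 0
    have hu1 := congrFun (heu i) 1
    simp only [hu', Matrix.mulVec, dotProduct, Fin.sum_univ_two, Pi.smul_apply, smul_eq_mul,
      Matrix.of_apply, Matrix.cons_val_zero, Matrix.cons_val_one, Matrix.cons_val',
      Matrix.cons_val_fin_one] at hu0 hu1
    have hoff : ∀ F : ℂ, F ≠ 0 → ∀ w : ℂ, -Complex.I * s * F * w = 0 → w = 0 := fun F hF w hw => by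
      simpa [hs', hF, Complex.I_ne_zero] using hw
    rcases mul_eq_zero.1 hz0 with h1 | h1
    · have h2 : e i 1 = 0 := (mul_eq_zero.1 hz1).resolve_left fun h2 => by
        have : (2 : ℂ) = 0 := by linear_combination h1 - h2
        norm_num at this
      rw [h2, mul_zero, mul_zero, add_zero] at hu1
      refine hne i (funext fun b => ?_)
      fin_cases b
      · exact hoff _ hE'0 _ hu1
      · exact h2
    · rw [h1, mul_zero, mul_zero, zero_add] at hu0
      refine hne i (funext fun b => ?_)
      fin_cases b
      · exact h1
      · exact hoff _ hE0 _ hu0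
  -- Since `k 0 - k 1 = 2 i y`, the real parts in question are `x / (2y)` and `-x / (2y)`.
  · have hI : ∀ w : ℂ, Complex.I * (w / (2 * y * Complex.I)) = ((1 / (2 * y) : ℝ) : ℂ) * w := by
      intro w
      push_cast
      field_simp
    intro i
    fin_cases i
    · simp only [Fin.zero_eta, Fin.isValue, zero_add]
      rw [hk01, hI, Complex.re_ofReal_mul, hre1]
      positivity
    · simp only [Fin.mk_one, Fin.isValue, Fin.reduceAdd]
      rw [← neg_sub, hk01, div_neg, mul_neg, hI, Complex.neg_re, Complex.re_ofReal_mul, hre]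
      exact neg_ne_zero.2 (by positivity)
  · exact fun h => hx ⟨k 0, Or.inl h, hre⟩
  · exact fun h => hx ⟨k 0, Or.inr h, hre⟩

/-! ### Tensor structure of the Floquet operator -/

/-- The tensor product `⨂_l f l` of one-qubit operators. -/
def productOp {N : ℕ} (f : Fin N → Matrix (Fin 2) (Fin 2) ℂ) : Op N :=
  Matrix.of fun s s' => ∏ l, f l (s l) (s' l)

theorem productOp_mul {N : ℕ} (f g : Fin N → Matrix (Fin 2) (Fin 2) ℂ) :
    productOp f * productOp g = productOp (f * g) := by
  ext s s'
  simp only [productOp, Matrix.mul_apply, Matrix.of_apply, Pi.mul_apply, Finset.prod_univ_sum,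
    Fintype.piFinset_univ, Finset.prod_mul_distrib]

theorem productOp_one {N : ℕ} : productOp (1 : Fin N → Matrix (Fin 2) (Fin 2) ℂ) = 1 := by
  ext s s'
  simp only [productOp, Matrix.of_apply, Pi.one_apply, Matrix.one_apply, Finset.prod_ite_zero,
    Finset.prod_const_one, Finset.mem_univ, true_implies, funext_iff]

theorem onSite_eq_productOp {N : ℕ} (l : Fin N) (M : Matrix (Fin 2) (Fin 2) ℂ) :
    onSite l M = productOp (Function.update 1 l M) := by
  ext s s'
  simp only [onSite, productOp, Matrix.of_apply]
  rw [← Finset.mul_prod_erase _ _ (Finset.mem_univ l), Function.update_self,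
    Finset.prod_congr rfl (g := fun k => if s k = s' k then (1 : ℂ) else 0), Finset.prod_ite_zero]
  · simp
  · intro k hk
    rw [Function.update_of_ne (Finset.ne_of_mem_erase hk), Pi.one_apply, Matrix.one_apply]

/-- The unnormalized Hadamard gate. -/
def hadamard : Matrix (Fin 2) (Fin 2) ℂ := !![1, 1; 1, -1]

theorem hadamard_mul_half : hadamard * ((1 / 2 : ℂ) • hadamard) = 1 := by
  ext i j
  fin_cases i <;> fin_cases j <;> simp [hadamard, Matrix.mul_apply] <;> norm_num

theorem pauliX_mul_hadamard : pauliX * hadamard = hadamard * pauliZ := by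
  ext i j
  fin_cases i <;> fin_cases j <;> simp [hadamard, Matrix.mul_apply, pauliX, pauliZ]

theorem kickGate_mul_hadamard (h : ℝ) : kickGate h * hadamard = hadamard * phaseGate h := by
  have h0 : Complex.exp (-(Complex.I / 2) * (h * zval 0)) =
      Real.cos (h / 2) - Complex.I * Real.sin (h / 2) := by
    have := Complex.exp_mul_I (-(h / 2 : ℂ))
    rw [Complex.cos_neg, Complex.sin_neg] at this
    push_cast
    rw [show -(Complex.I / 2) * (h * zval 0) = -(h / 2 : ℂ) * Complex.I by simp [zval]; ring, this]
    ring
  have h1 : Complex.exp (-(Complex.I / 2) * (h * zval 1)) =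
      Real.cos (h / 2) + Complex.I * Real.sin (h / 2) := by
    have := Complex.exp_mul_I (h / 2 : ℂ)
    push_cast
    rw [show -(Complex.I / 2) * (h * zval 1) = (h / 2 : ℂ) * Complex.I by simp [zval]; ring, this]
    ring
  ext i j
  rw [phaseGate, Matrix.mul_diagonal, Matrix.mul_apply, Fin.sum_univ_two]
  fin_cases i <;> fin_cases j <;>
    simp only [Fin.zero_eta, Fin.mk_one, Fin.isValue, h0, h1] <;> simp [hadamard, kickGate] <;> ring

theorem onSite_pauliX_mul_hadamard {N : ℕ} (l : Fin N) :
    onSite l pauliX * productOp (fun _ => hadamard) =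
      productOp (fun _ => hadamard) * onSite l pauliZ := by
  rw [onSite_eq_productOp, onSite_eq_productOp, productOp_mul, productOp_mul]
  congr 1
  ext1 k
  simp only [Pi.mul_apply]
  rcases eq_or_ne k l with rfl | hk
  · rw [Function.update_self, Function.update_self, pauliX_mul_hadamard]
  · rw [Function.update_of_ne hk, Function.update_of_ne hk, Pi.one_apply, one_mul, mul_one]

/-- The evolution with the transverse fields is a product of one-qubit gates. -/
theorem exp_H₂_eq {N : ℕ} (p : Params N) :
    NormedSpace.exp ((1 / 2 : ℝ) • (-Complex.I • H₂ p)) = productOp fun l => kickGate (p.1 l) := by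
  set Q : Op N := productOp fun _ => hadamard with hQ
  set Q' : Op N := productOp fun _ => (1 / 2 : ℂ) • hadamard with hQ'
  set d : Basis N → ℂ := fun s => ∑ l, -(Complex.I / 2) * (p.1 l * zval (s l)) with hd
  have hQQ : Q * Q' = 1 := by
    rw [hQ, hQ', productOp_mul, ← productOp_one]
    congr 1
    ext1 l
    exact hadamard_mul_half
  -- Hadamard gates on all sites turn every `σˣ` into `σᶻ`, so the exponential becomes that of a
  -- diagonal matrix and factors over the sites.
  have hH : (1 / 2 : ℝ) • (-Complex.I • H₂ p) = Q * Matrix.diagonal d * Q' := by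
    have h1 : ((1 / 2 : ℝ) • (-Complex.I • H₂ p)) * Q = Q * Matrix.diagonal d := by
      have h2 : Matrix.diagonal d = (-(Complex.I / 2)) • ∑ l, (p.1 l : ℂ) • onSite l pauliZ := by
        ext s s'
        simp only [onSite_pauliZ, Matrix.smul_apply, Matrix.sum_apply, Matrix.diagonal_apply, hd]
        split_ifs <;> simp [Finset.mul_sum]
      rw [h2, H₂, ← Complex.coe_smul, smul_smul, smul_mul_assoc, mul_smul_comm, Finset.sum_mul,
        Finset.mul_sum]
      congr 1
      · push_cast; ring
      · refine Finset.sum_congr rfl fun l _ => ?_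
        rw [smul_mul_assoc, mul_smul_comm, onSite_pauliX_mul_hadamard]
    rw [← h1, mul_assoc, hQQ, mul_one]
  have hinv : Q⁻¹ = Q' := Matrix.inv_eq_right_inv hQQ
  have hexp : NormedSpace.exp (Matrix.diagonal d) = productOp fun l => phaseGate (p.1 l) := by
    rw [Matrix.exp_diagonal]
    ext s s'
    simp only [productOp, Matrix.of_apply, phaseGate, Matrix.diagonal_apply, Finset.prod_ite_zero,
      Finset.mem_univ, true_implies, funext_iff]
    split_ifs
    · rw [Pi.coe_exp, ← Complex.exp_eq_exp_ℂ, hd, Complex.exp_sum]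
    · rfl
  have hQu : IsUnit Q := by
    rw [Matrix.isUnit_iff_isUnit_det]
    exact Matrix.isUnit_det_of_right_inverse hQQ
  rw [hH, ← hinv, Matrix.exp_conj _ _ hQu, hexp, hinv]
  have : Q * productOp (fun l => phaseGate (p.1 l)) =
      productOp (fun l => kickGate (p.1 l)) * Q := by
    rw [hQ, productOp_mul, productOp_mul]
    congr 1
    ext1 l
    exact (kickGate_mul_hadamard _).symm
  rw [this, mul_assoc, hQQ, mul_one]

theorem exp_H₁_eq {N : ℕ} (p : Params N) :
    NormedSpace.exp ((1 / 2 : ℝ) • (-Complex.I • H₁ p)) =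
      Matrix.diagonal fun s => Complex.exp (-(Complex.I / 2) * energy p s) := by
  have h : (1 / 2 : ℝ) • (-Complex.I • H₁ p) =
      Matrix.diagonal fun s => -(Complex.I / 2) * (energy p s : ℂ) := by
    rw [H₁_eq, ← Complex.coe_smul, smul_smul, ← Matrix.diagonal_smul]
    congr 1
    ext s
    simp only [Pi.smul_apply, smul_eq_mul]
    push_cast
    ring
  rw [h, Matrix.exp_diagonal]
  congr 1
  ext s
  rw [Pi.coe_exp, ← Complex.exp_eq_exp_ℂ]

theorem floquetOp_eq {N : ℕ} (p : Params N) :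
    floquetOp p = productOp (fun l => kickGate (p.1 l)) *
      Matrix.diagonal fun s => Complex.exp (-(Complex.I / 2) * energy p s) := by
  rw [floquetOp, partialPeriod, ← exp_H₁_eq, ← exp_H₂_eq]
  norm_num

/-- The parameters of a chain extended by a site in front. -/
def consParams {n : ℕ} (a b t : ℝ) (p : Params (n + 1)) : Params (n + 2) :=
  (Fin.cons a p.1, Fin.cons b p.2.1, Fin.cons (n := n) (α := fun _ => ℝ) t p.2.2)

theorem energy_consParams {n : ℕ} (a b t : ℝ) (p : Params (n + 1)) (s : Basis (n + 2)) :
    energy (consParams a b t p) s =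
      b * zval (s 0) + t * (zval (s 0) * zval (s 1)) + energy p (Fin.tail s) := by
  have h1 : ∑ l : Fin (n + 2), (consParams a b t p).2.1 l * zval (s l) =
      b * zval (s 0) + ∑ l : Fin (n + 1), p.2.1 l * zval (Fin.tail s l) := by
    rw [Fin.sum_univ_succ]
    rfl
  have h2 : ∑ l : Fin (n + 2 - 1), (consParams a b t p).2.2 l *
        (zval (s (bondLeft l)) * zval (s (bondRight l))) =
      t * (zval (s 0) * zval (s 1)) + ∑ l : Fin (n + 1 - 1), p.2.2 l *
        (zval (Fin.tail s (bondLeft l)) * zval (Fin.tail s (bondRight l))) :=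
    Fin.sum_univ_succ (n := n) fun l : Fin (n + 1) => (consParams a b t p).2.2 l *
        (zval (s (bondLeft (N := n + 2) l)) * zval (s (bondRight (N := n + 2) l)))
  rw [energy, energy, h1, h2]
  ring

/-- The new site touches the chain only through the bond to its first site. The bond gate is
diagonal, with `σᶻ` of the old first site as system observable and the bond strength as perturbation
parameter. This is why genericity is tracked for `σᶻ` at site `0`. -/
theorem floquetOp_consParams {n : ℕ} (a b t : ℝ) (p : Params (n + 1)) :
    floquetOp (consParams a b t p) =
      (((kickGate a * phaseGate b) ⊗ₖ floquetOp p) *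
        Matrix.diagonal fun x : Fin 2 × Basis (n + 1) =>
          Complex.exp (t * (-(Complex.I / 2) * (zval x.1 * zval (x.2 0))))).submatrix
        (Fin.consEquiv fun _ : Fin (n + 2) => Fin 2).symm
        (Fin.consEquiv fun _ : Fin (n + 2) => Fin 2).symm := by
  ext s s'
  have hE : ∀ s : Basis (n + 2), (Fin.consEquiv fun _ : Fin (n + 2) => Fin 2).symm s =
    (s 0, Fin.tail s) := fun _ => rfl
  rw [Matrix.submatrix_apply, hE, hE, floquetOp_eq, floquetOp_eq, Matrix.mul_diagonal,
    Matrix.mul_diagonal, Matrix.kroneckerMap_apply, Matrix.mul_diagonal, phaseGate,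
    Matrix.mul_diagonal, energy_consParams]
  have hK : productOp (fun l => kickGate ((consParams a b t p).1 l)) s s' =
      kickGate a (s 0) (s' 0) *
        productOp (fun l => kickGate (p.1 l)) (Fin.tail s) (Fin.tail s') := by
    simp only [productOp, Matrix.of_apply]
    rw [Fin.prod_univ_succ]
    rfl
  have hexp : Complex.exp (-(Complex.I / 2) * ((b * zval (s' 0) + t * (zval (s' 0) * zval (s' 1)) +
        energy p (Fin.tail s') : ℝ) : ℂ)) =
      Complex.exp (-(Complex.I / 2) * (b * zval (s' 0))) *
      Complex.exp (-(Complex.I / 2) * energy p (Fin.tail s')) *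
      Complex.exp (t * (-(Complex.I / 2) * (zval (s' 0) * zval (s' 1)))) := by
    rw [← Complex.exp_add, ← Complex.exp_add]
    congr 1
    push_cast
    ring
  rw [hK, hexp]
  simp only [Fin.tail, Fin.succ_zero_eq_one]
  ring

/-- The parameters of a single site. -/
def singleParams (a b : ℝ) : Params 1 := (fun _ => a, fun _ => b, fun _ => 0)

/-- A single qubit is seen as coupled to a one-dimensional system with observable `1`, so that the
base case of the induction is the coupling step too; the coupling strength merely adds to the
longitudinal field. -/
theorem floquetOp_singleParams (a b t : ℝ) :
    floquetOp (singleParams a (b + t)) =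
      (((kickGate a * phaseGate b) ⊗ₖ (1 : Matrix Unit Unit ℂ)) *
        Matrix.diagonal fun x : Fin 2 × Unit =>
          Complex.exp (t * (-(Complex.I / 2) * (zval x.1 * ((1 : ℝ) : ℂ))))).submatrix
        ((Equiv.funUnique (Fin 1) (Fin 2)).trans (Equiv.prodUnique (Fin 2) Unit).symm)
        ((Equiv.funUnique (Fin 1) (Fin 2)).trans (Equiv.prodUnique (Fin 2) Unit).symm) := by
  ext s s'
  have hE : ∀ s : Basis 1, ((Equiv.funUnique (Fin 1) (Fin 2)).trans
    (Equiv.prodUnique (Fin 2) Unit).symm) s = (s 0, ()) := fun _ => rfl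
  have hen : energy (singleParams a (b + t)) s' = (b + t) * zval (s' 0) := by
    simp [energy, singleParams]
  rw [Matrix.submatrix_apply, hE, hE, floquetOp_eq, Matrix.mul_diagonal, Matrix.mul_diagonal,
    Matrix.kroneckerMap_apply, phaseGate, Matrix.mul_diagonal, hen]
  have hexp : Complex.exp (-(Complex.I / 2) * (((b + t) * zval (s' 0) : ℝ) : ℂ)) =
      Complex.exp (-(Complex.I / 2) * (b * zval (s' 0))) *
      Complex.exp (t * (-(Complex.I / 2) * (zval (s' 0) * ((1 : ℝ) : ℂ)))) := by
    rw [← Complex.exp_add]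
    congr 1
    push_cast
    ring
  rw [hexp]
  simp [productOp, singleParams]
  ring

/-! ### Generic chains of every length -/

/-- A generic system can be coupled to a suitable qubit so that it stays generic. -/
theorem exists_isGeneric_gate_coupling {ι : Type*} [Fintype ι] [DecidableEq ι]
    {V : Matrix ι ι ℂ} (hV : V ∈ Matrix.unitaryGroup ι ℂ) {ζ : ι → ℝ} (h : IsGeneric V ζ) :
    ∃ a b t : ℝ, IsGeneric (((kickGate a * phaseGate b) ⊗ₖ V) *
      Matrix.diagonal fun x : Fin 2 × ι =>
        Complex.exp (t * (-(Complex.I / 2) * (zval x.1 * ζ x.2)))) (fun x => zval x.1) := by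
  obtain ⟨v, μ, heig, hv, hμ, hq⟩ := h
  have hμ0 : ∀ j, μ j ≠ 0 := fun j => right_ne_zero_of_mul_eq_one
    (Matrix.star_mul_self_eigenvalue hV (hv.ne_zero j) (heig j))
  obtain ⟨a, b, e, k, heu, he, hk, hr, hγ, hY, h2, h4⟩ := exists_qubit_gate
    (Set.finite_range fun x : (ι × ι) × ι × ι => μ x.2.1 * μ x.2.2 / (μ x.1.1 * μ x.1.2))
  have havoid : ∀ w, w ∉ Set.range (fun x : (ι × ι) × ι × ι =>
      μ x.2.1 * μ x.2.2 / (μ x.1.1 * μ x.1.2)) → ∀ i j l m, w * (μ i * μ j) ≠ μ l * μ m := by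
    intro w hw i j l m h
    exact hw ⟨((i, j), l, m), (div_eq_iff (mul_ne_zero (hμ0 i) (hμ0 j))).2 h.symm⟩
  obtain ⟨t, ht⟩ := exists_isGeneric_coupling
    (mul_mem (kickGate_mem_unitaryGroup a) (phaseGate_mem_unitaryGroup b)) heu he hk hr hγ hY hV
    heig hv hμ hq (havoid _ h2) (havoid _ h4)
  exact ⟨a, b, t, ht⟩

/-- For every number of qubits there are parameters with a generic Floquet operator. -/
theorem exists_isGeneric_floquetOp (n : ℕ) :
    ∃ p : Params (n + 1), IsGeneric (floquetOp p) fun s => zval (s 0) := by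
  induction n with
  | zero =>
    have h : IsGeneric (1 : Matrix Unit Unit ℂ) (fun _ => 1) :=
      ⟨fun _ _ => 1, fun _ => 1, fun j => by simp, fun j k => by simp,
        fun _ _ _ _ _ => Or.inl ⟨rfl, rfl⟩, fun _ _ _ => rfl⟩
    obtain ⟨a, b, t, ht⟩ := exists_isGeneric_gate_coupling (one_mem _) h
    refine ⟨singleParams a (b + t), ?_⟩
    rw [floquetOp_singleParams]
    exact ht.reindex _
  | succ n ih =>
    obtain ⟨p, hp⟩ := ih
    obtain ⟨a, b, t, ht⟩ := exists_isGeneric_gate_coupling (floquetOp_mem_unitary p) hp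
    refine ⟨consParams a b t p, ?_⟩
    rw [floquetOp_consParams]
    exact ht.reindex _

/-- One generic parameter point makes the analytic function `symDisc (floquetOp p)` not identically
zero, hence nonzero almost everywhere. The null set depends neither on the observable nor on the
state. -/
theorem ae_hasDistinctProducts {N : ℕ} (hN : 1 ≤ N) :
    ∀ᵐ p : Params N, ∃ W ∈ Matrix.unitaryGroup (Basis N) ℂ, ∃ μ,
      floquetOp p * W = W * Matrix.diagonal μ ∧ HasDistinctProducts μ := by
  obtain ⟨n, rfl⟩ := Nat.exists_eq_add_of_le' hN
  obtain ⟨p₀, hp₀⟩ := exists_isGeneric_floquetOp n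
  filter_upwards [ae_symDisc_floquetOp_ne_zero hp₀.symDisc_ne_zero] with p hp
  obtain ⟨W, hW, μ, hWμ⟩ := Matrix.exists_diagonalization_of_mem_unitaryGroup
    (floquetOp_mem_unitary p)
  exact ⟨W, hW, μ, hWμ, (symDisc_ne_zero_iff hW hWμ).1 hp⟩

end KickedIsing

/-! ### Choice of constants and conclusion -/

/-- With `ε = exp(-N/10)` the participation threshold is `ε²` and the failure probability must be at
most `ε`, so `(2/3)ᴺ ≤ ε³` is required; this holds since `2/3 ≤ 1 - 3/10 ≤ exp(-3/10)`. -/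
theorem two_thirds_pow_div_exp_le (N : ℕ) :
    (2 / 3 : ℝ) ^ N / Real.exp (-(1 / 10 * N)) ^ 2 ≤ Real.exp (-(1 / 10 * N)) := by
  rw [div_le_iff₀ (by positivity), ← pow_succ', ← Real.exp_nat_mul]
  have h : (2 / 3 : ℝ) ≤ Real.exp (-(3 / 10)) := by
    have := Real.add_one_le_exp (-(3 / 10) : ℝ)
    linarith
  calc (2 / 3 : ℝ) ^ N ≤ Real.exp (-(3 / 10)) ^ N := by gcongr
    _ = _ := by
      rw [← Real.exp_nat_mul]
      congr 1
      push_cast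
      ring

end

theorem theorem1 :
    ∃ c : ℝ, 0 < c ∧ ∃ N₀ : ℕ, ∀ N : ℕ, N₀ ≤ N →
      ∀ᵐ p : KickedIsing.Params N,
        ∀ A : KickedIsing.Op N, A.IsHermitian → ‖A‖ = 1 →
          KickedIsing.haarProduct N
              {φ | ¬ KickedIsing.IsApproxPeriodic (Real.exp (-(c * N)))
                (KickedIsing.expectation p A (KickedIsing.productState φ))} ≤
            ENNReal.ofReal (Real.exp (-(c * N))) := by
  -- The threshold `N₀ = 1` only ensures that the chain has a site.
  refine ⟨1 / 10, by norm_num, 1, fun N hN => ?_⟩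
  filter_upwards [KickedIsing.ae_hasDistinctProducts hN] with p hp A _ hA
  obtain ⟨W, hW, μ, hWμ, hμ⟩ := hp
  refine (measure_mono fun φ hφ => ?_).trans
    ((KickedIsing.haarProduct_participation_gt_le hW (δ := Real.exp (-(1 / 10 * N)) ^ 2)
      (by positivity)).trans (ENNReal.ofReal_le_ofReal (two_thirds_pow_div_exp_le N)))
  by_contra h
  exact hφ (KickedIsing.isApproxPeriodic_expectation hW hWμ hμ hA.le (Real.exp_pos _) (not_lt.1 h))
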